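/- Let $0\to J\xrightarrow{\iota} A\xrightarrow{\pi} B\to 0$ be an extension (short exact sequence) of C$^*$-algebras; identify $J$ with the ideal $\iota(J)$ of $A$ and $B$ with $A/J$. "Ideal" means closed two-sided ideal, and a subset of a C$^*$-algebra is called full if the ideal it generates is the whole algebra. Let $M(J)$ be the multiplier algebra, $Q(J)=M(J)/J$ the corona algebra, and $\beta:B\to Q(J)$ the Busby invariant, i.e. the $^*$-homomorphism induced by the map $A\to M(J)$ given by multiplication on $J$. A C$^*$-algebra $C$ is stable if $C\cong C\otimes\mathbb K$, where $\mathbb K$ is the algebra of compact operators on $\ell^2(\mathbb N)$; it is $\sigma$-unital if it has a countable approximate unit; it is purely infinite if it has no characters (non-zero $^*$-homomorphisms to $\mathbb C$) and if, for all positive $a,b\in C$ with $a$ in the ideal generated by $b$, there is a sequence $(r_i)$ in $C$ with $a=\lim_i r_i^*br_i$. The extension is full if $\beta(b)$ is full in $Q(J)$ for every non-zero $b\in B$. It is purely large if for every $a\in A\setminus J$ the hereditary subalgebra $\overline{aJa^*}$ contains a stable, $\sigma$-unital C$^*$-subalgebra $D$ that is full in $J$. Proposition. Suppose that $B$ is purely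 infinite, that $J$ is stable and $\sigma$-unital, and that the extension $0\to J\to A\to B\to 0$ is full. Then it is purely large. -/

import Mathlib

open scoped TensorProduct MultiplierAlgebra Topology
open Filter

/-! ### Closed ideals, positivity, Cuntz comparison, pure infiniteness -/

/-- The closed two-sided ideal generated by a set `S`, as the closure of the algebraic two-sided
ideal generated by `S`. (In a C⋆-algebra it is automatically closed under complex scalars.) -/
def closedIdealSpan {R : Type*} [NonUnitalRing R] [TopologicalSpace R] (S : Set R) : Set R :=
  closure (TwoSidedIdeal.span S : Set R)

/-- A subset is full if the closed two-sided ideal that it generates is everything. -/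
def IsFullSet {R : Type*} [NonUnitalRing R] [TopologicalSpace R] (S : Set R) : Prop :=
  closedIdealSpan S = Set.univ

/-- The positive cone `A₊` of a C⋆-algebra: the elements of the form `b⋆ b`. -/
def positiveCone (A : Type*) [NonUnitalCStarAlgebra A] : Set A :=
  {a | ∃ b : A, a = star b * b}

/-- Cuntz subequivalence: `a = lim rᵢ⋆ b rᵢ` for some sequence `rᵢ` in `A`. -/
def CuntzLE {A : Type*} [NonUnitalCStarAlgebra A] (a b : A) : Prop :=
  ∃ r : ℕ → A, Tendsto (fun i => star (r i) * b * r i) atTop (𝓝 a)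

/-- A C⋆-algebra is purely infinite (Kirchberg and Rørdam) if it has no characters, i.e. every
⋆-homomorphism to `ℂ` vanishes, and any positive element of the closed ideal generated by a
positive element `b` is Cuntz subequivalent to `b`. -/
def IsPurelyInfinite (A : Type*) [NonUnitalCStarAlgebra A] : Prop :=
  (∀ χ : A →⋆ₙₐ[ℂ] ℂ, χ = 0) ∧
    ∀ a ∈ positiveCone A, ∀ b ∈ positiveCone A, a ∈ closedIdealSpan {b} → CuntzLE a b

/-- A C⋆-algebra is σ-unital if it has a countable approximate unit: an increasing sequence of
positive elements in the unit ball that is a left and right approximate identity. -/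
def IsSigmaUnital (A : Type*) [NonUnitalCStarAlgebra A] : Prop :=
  ∃ u : ℕ → A, (∀ n, u n ∈ positiveCone A) ∧ (∀ n, ‖u n‖ ≤ 1) ∧
    (∀ m n, m ≤ n → u n - u m ∈ positiveCone A) ∧
    ∀ a : A, Tendsto (fun n => u n * a) atTop (𝓝 a) ∧ Tendsto (fun n => a * u n) atTop (𝓝 a)

/-! ### Compact operators and stability -/

/-- The Hilbert space `ℓ²(ℕ)`. -/
abbrev EllTwo : Type := lp (fun _ : ℕ => ℂ) 2

/-- The adjoint of a compact operator on a Hilbert space is compact. -/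
theorem isCompactOperator_star {H : Type*} [NormedAddCommGroup H] [InnerProductSpace ℂ H]
    [CompleteSpace H] {T : H →L[ℂ] H} (hT : IsCompactOperator T) :
    IsCompactOperator (star T : H →L[ℂ] H) := by
  have hTS : IsCompactOperator (T ∘L (star T : H →L[ℂ] H)) := hT.comp_clm (star T : H →L[ℂ] H)
  obtain ⟨K, hK, hsub⟩ := IsCompactOperator.image_closedBall_subset_compact
    (f := ((T ∘L (star T : H →L[ℂ] H) : H →L[ℂ] H) : H →ₗ[ℂ] H)) hTS 1
  have htb : TotallyBounded
      ((fun x => T ((star T : H →L[ℂ] H) x)) '' Metric.closedBall (0 : H) 1) :=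
    hK.totallyBounded.subset hsub
  have key : TotallyBounded ((star T : H →L[ℂ] H) '' Metric.closedBall (0 : H) 1) := by
    rw [Metric.totallyBounded_iff]
    intro ε hε
    obtain ⟨t, hts, htf, hcov⟩ := totallyBounded_iff_subset.1 htb _
      (Metric.dist_mem_uniformity (show 0 < ε ^ 2 / 4 by positivity))
    have hts' : ∀ y ∈ t, ∃ x ∈ Metric.closedBall (0 : H) 1, T ((star T : H →L[ℂ] H) x) = y :=
      fun y hy => hts hy
    choose! g hg hgt using hts'
    refine ⟨(fun y => (star T : H →L[ℂ] H) (g y)) '' t, htf.image _, ?_⟩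
    rintro _ ⟨x, hx, rfl⟩
    obtain ⟨y, hyt, hy⟩ := Set.mem_iUnion₂.1 (hcov ⟨x, hx, rfl⟩)
    refine Set.mem_iUnion₂.2 ⟨_, ⟨y, hyt, rfl⟩, ?_⟩
    have hy' : ‖T ((star T : H →L[ℂ] H) (x - g y))‖ < ε ^ 2 / 4 := by
      rw [map_sub, map_sub]
      have h1 : dist (T ((star T : H →L[ℂ] H) x)) y < ε ^ 2 / 4 := hy
      rw [← hgt y hyt, dist_eq_norm] at h1
      exact h1
    have hgy := hg y hyt
    rw [mem_closedBall_zero_iff] at hx hgy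
    have hxg : ‖x - g y‖ ≤ 2 := (norm_sub_le _ _).trans (by linarith)
    have hsq : ‖(star T : H →L[ℂ] H) (x - g y)‖ ^ 2 ≤
        ‖x - g y‖ * ‖T ((star T : H →L[ℂ] H) (x - g y))‖ := by
      rw [← @inner_self_eq_norm_sq ℂ H, ContinuousLinearMap.star_eq_adjoint,
        ContinuousLinearMap.adjoint_inner_left]
      exact (RCLike.re_le_norm _).trans (norm_inner_le_norm _ _)
    rw [Metric.mem_ball, dist_eq_norm, ← map_sub]
    have h0 := norm_nonneg (T ((star T : H →L[ℂ] H) (x - g y)))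
    nlinarith [norm_nonneg ((star T : H →L[ℂ] H) (x - g y))]
  refine (isCompactOperator_iff_image_closedBall_subset_compact
    ((star T : H →L[ℂ] H) : H →ₗ[ℂ] H) one_pos).2
    ⟨_, key.closure.isCompact_of_isClosed isClosed_closure, subset_closure⟩

/-- The C⋆-algebra `𝕂` of compact operators on `ℓ²(ℕ)`. -/
def compactOps : NonUnitalStarSubalgebra ℂ (EllTwo →L[ℂ] EllTwo) where
  carrier := {T | IsCompactOperator T}
  add_mem' hS hT := hS.add hT
  zero_mem' := isCompactOperator_zero
  mul_mem' {_ T} hS _ := hS.comp_clm T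
  smul_mem' c _ hT := hT.smul c
  star_mem' hT := isCompactOperator_star hT

/-- `C` is the C⋆-tensor product `A ⊗ 𝕂`: the algebraic tensor product of `A` and `𝕂` embeds as a
dense ⋆-subalgebra of the C⋆-algebra `C`. As `𝕂` is nuclear, the algebraic tensor product has
exactly one C⋆-norm, so this determines `C` up to isomorphism. -/
def IsStabilization (A C : Type*) [NonUnitalCStarAlgebra A] [NonUnitalCStarAlgebra C] : Prop :=
  ∃ Φ : (A ⊗[ℂ] compactOps) →⋆ₙₐ[ℂ] C, Function.Injective Φ ∧ DenseRange Φ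

/-- A C⋆-algebra `A` is stable if `A ≅ A ⊗ 𝕂`, i.e. if `A` itself is a C⋆-tensor product of `A`
and `𝕂`. -/
def IsStable (A : Type*) [NonUnitalCStarAlgebra A] : Prop :=
  IsStabilization A A

/-! ### The corona algebra -/

section Corona

variable (J : Type*) [NonUnitalCStarAlgebra J]

/-- The canonical copy of `J` in `M(J)`, as an ideal. -/
noncomputable def coronaIdeal : Ideal 𝓜(ℂ, J) where
  carrier := Set.range (DoubleCentralizer.coeHom (𝕜 := ℂ) (A := J))
  add_mem' := by
    rintro _ _ ⟨x, rfl⟩ ⟨y, rfl⟩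
    exact ⟨x + y, map_add _ _ _⟩
  zero_mem' := ⟨0, map_zero _⟩
  smul_mem' := by
    rintro m _ ⟨x, rfl⟩
    refine ⟨m.fst x, ?_⟩
    refine DoubleCentralizer.ext _ _ _ _ (Prod.ext ?_ ?_) <;>
      refine ContinuousLinearMap.ext fun y => ?_
    · change m.fst x * y = m.fst (x * y)
      refine eq_of_sub_eq_zero ?_
      apply (CStarRing.star_mul_self_eq_zero_iff _).1
      rw [mul_sub, ← mul_assoc, ← m.central, ← m.central, mul_assoc, sub_self]
    · change y * m.fst x = m.snd y * x
      exact (m.central _ _).symm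

instance : (coronaIdeal J).IsTwoSided where
  mul_mem_of_left := by
    rintro _ m ⟨x, rfl⟩
    refine ⟨m.snd x, ?_⟩
    refine DoubleCentralizer.ext _ _ _ _ (Prod.ext ?_ ?_) <;>
      refine ContinuousLinearMap.ext fun y => ?_
    · change m.snd x * y = x * m.fst y
      exact m.central _ _
    · change y * m.snd x = m.snd (y * x)
      refine eq_of_sub_eq_zero ?_
      apply (CStarRing.mul_star_self_eq_zero_iff _).1
      rw [sub_mul, mul_assoc, m.central, m.central, mul_assoc, sub_self]

/-- The corona algebra `Q(J) = M(J)/J`, with the quotient norm. -/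
abbrev Corona : Type _ := 𝓜(ℂ, J) ⧸ coronaIdeal J

/-- The quotient map `M(J) → Q(J)`. -/
noncomputable abbrev Corona.mk : 𝓜(ℂ, J) →+* Corona J := Ideal.Quotient.mk (coronaIdeal J)

theorem coronaIdeal_star_mem {m : 𝓜(ℂ, J)} (hm : m ∈ coronaIdeal J) :
    star m ∈ coronaIdeal J := by
  obtain ⟨x, rfl⟩ := hm
  exact ⟨star x, map_star _ _⟩

noncomputable instance : Star (Corona J) where
  star := Quotient.map' star fun a b h => by
    rw [Submodule.quotientRel_def] at h ⊢
    rw [← star_sub]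
    exact coronaIdeal_star_mem J h

theorem Corona.star_mk (m : 𝓜(ℂ, J)) : star (Corona.mk J m) = Corona.mk J (star m) := rfl

noncomputable instance : StarRing (Corona J) where
  star_involutive q := by
    obtain ⟨m, rfl⟩ := Ideal.Quotient.mk_surjective q
    simp only [Corona.star_mk, star_star]
  star_mul p q := by
    obtain ⟨m, rfl⟩ := Ideal.Quotient.mk_surjective p
    obtain ⟨n, rfl⟩ := Ideal.Quotient.mk_surjective q
    simp only [Corona.star_mk, ← map_mul, star_mul]
  star_add p q := by
    obtain ⟨m, rfl⟩ := Ideal.Quotient.mk_surjective p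
    obtain ⟨n, rfl⟩ := Ideal.Quotient.mk_surjective q
    simp only [Corona.star_mk, ← map_add, star_add]

end Corona

/-! ### Extensions and the Busby invariant -/

/-- An extension `0 → J → A → B → 0` of C⋆-algebras: a short exact sequence of
⋆-homomorphisms. -/
structure CStarExtension (J A B : Type*) [NonUnitalCStarAlgebra J] [NonUnitalCStarAlgebra A]
    [NonUnitalCStarAlgebra B] where
  /-- The inclusion of the ideal. -/
  incl : J →⋆ₙₐ[ℂ] A
  /-- The quotient map. -/
  proj : A →⋆ₙₐ[ℂ] B
  incl_injective : Function.Injective incl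
  exact : ∀ a : A, proj a = 0 ↔ a ∈ Set.range incl
  proj_surjective : Function.Surjective proj

namespace CStarExtension

section Busby

variable {J A B : Type*} [NonUnitalCStarAlgebra J] [NonUnitalCStarAlgebra A]
  [NonUnitalCStarAlgebra B] (E : CStarExtension J A B)

theorem proj_incl (j : J) : E.proj (E.incl j) = 0 := (E.exact _).2 ⟨j, rfl⟩

theorem exists_left (a : A) (j : J) : ∃ k : J, E.incl k = a * E.incl j :=
  (E.exact _).1 (by rw [map_mul, proj_incl, mul_zero])

theorem exists_right (a : A) (j : J) : ∃ k : J, E.incl k = E.incl j * a :=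
  (E.exact _).1 (by rw [map_mul, proj_incl, zero_mul])

theorem norm_incl (j : J) : ‖E.incl j‖ = ‖j‖ :=
  NonUnitalStarAlgHom.norm_map E.incl E.incl_injective j

/-- Left multiplication by `a ∈ A` on the ideal `J`, as a plain function. -/
noncomputable def leftFun (a : A) (j : J) : J := (E.exists_left a j).choose

theorem incl_leftFun (a : A) (j : J) : E.incl (E.leftFun a j) = a * E.incl j :=
  (E.exists_left a j).choose_spec

/-- Left multiplication by `a ∈ A` on the ideal `J`. -/
noncomputable def leftMul (a : A) : J →L[ℂ] J :=
  LinearMap.mkContinuous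
    { toFun := E.leftFun a
      map_add' := fun j k => E.incl_injective (by
        rw [map_add, incl_leftFun, incl_leftFun, incl_leftFun, map_add, mul_add])
      map_smul' := fun c j => E.incl_injective (by
        rw [RingHom.id_apply, map_smul, incl_leftFun, incl_leftFun, map_smul, mul_smul_comm]) }
    ‖a‖ fun j => by
      rw [← E.norm_incl, ← E.norm_incl j]
      change ‖E.incl (E.leftFun a j)‖ ≤ _
      rw [incl_leftFun]
      exact norm_mul_le _ _

/-- Right multiplication by `a ∈ A` on the ideal `J`, as a plain function. -/
noncomputable def rightFun (a : A) (j : J) : J := (E.exists_right a j).choose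

theorem incl_rightFun (a : A) (j : J) : E.incl (E.rightFun a j) = E.incl j * a :=
  (E.exists_right a j).choose_spec

/-- Right multiplication by `a ∈ A` on the ideal `J`. -/
noncomputable def rightMul (a : A) : J →L[ℂ] J :=
  LinearMap.mkContinuous
    { toFun := E.rightFun a
      map_add' := fun j k => E.incl_injective (by
        rw [map_add, incl_rightFun, incl_rightFun, incl_rightFun, map_add, add_mul])
      map_smul' := fun c j => E.incl_injective (by
        rw [RingHom.id_apply, map_smul, incl_rightFun, incl_rightFun, map_smul, smul_mul_assoc]) }
    ‖a‖ fun j => by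
      rw [← E.norm_incl, ← E.norm_incl j]
      change ‖E.incl (E.rightFun a j)‖ ≤ _
      rw [incl_rightFun, mul_comm ‖a‖]
      exact norm_mul_le _ _

theorem incl_leftMul (a : A) (j : J) : E.incl (E.leftMul a j) = a * E.incl j :=
  E.incl_leftFun a j

theorem incl_rightMul (a : A) (j : J) : E.incl (E.rightMul a j) = E.incl j * a :=
  E.incl_rightFun a j

theorem multiplier_ext {m n : 𝓜(ℂ, J)} (h₁ : ∀ j, E.incl (m.fst j) = E.incl (n.fst j))
    (h₂ : ∀ j, E.incl (m.snd j) = E.incl (n.snd j)) : m = n :=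
  DoubleCentralizer.ext _ _ _ _ (Prod.ext
    (ContinuousLinearMap.ext fun j => E.incl_injective (h₁ j))
    (ContinuousLinearMap.ext fun j => E.incl_injective (h₂ j)))

/-- The canonical ⋆-homomorphism `A → M(J)`: each `a ∈ A` acts on `J` by multiplication. -/
noncomputable def toMultiplier : A →⋆ₙₐ[ℂ] 𝓜(ℂ, J) where
  toFun a :=
    { fst := E.leftMul a
      snd := E.rightMul a
      central := fun x y => E.incl_injective (by
        rw [map_mul, map_mul, incl_leftMul, incl_rightMul, mul_assoc]) }
  map_smul' c a := E.multiplier_ext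
    (fun j => by
      change E.incl (E.leftMul (c • a) j) = E.incl (c • E.leftMul a j)
      rw [map_smul, incl_leftMul, incl_leftMul, smul_mul_assoc])
    (fun j => by
      change E.incl (E.rightMul (c • a) j) = E.incl (c • E.rightMul a j)
      rw [map_smul, incl_rightMul, incl_rightMul, mul_smul_comm])
  map_zero' := E.multiplier_ext
    (fun j => by
      change E.incl (E.leftMul 0 j) = E.incl 0
      rw [map_zero, incl_leftMul, zero_mul])
    (fun j => by
      change E.incl (E.rightMul 0 j) = E.incl 0
      rw [map_zero, incl_rightMul, mul_zero])
  map_add' a b := E.multiplier_ext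
    (fun j => by
      change E.incl (E.leftMul (a + b) j) = E.incl (E.leftMul a j + E.leftMul b j)
      rw [map_add, incl_leftMul, incl_leftMul, incl_leftMul, add_mul])
    (fun j => by
      change E.incl (E.rightMul (a + b) j) = E.incl (E.rightMul a j + E.rightMul b j)
      rw [map_add, incl_rightMul, incl_rightMul, incl_rightMul, mul_add])
  map_mul' a b := E.multiplier_ext
    (fun j => by
      change E.incl (E.leftMul (a * b) j) = E.incl (E.leftMul a (E.leftMul b j))
      rw [incl_leftMul, incl_leftMul, incl_leftMul, mul_assoc])
    (fun j => by
      change E.incl (E.rightMul (a * b) j) = E.incl (E.rightMul b (E.rightMul a j))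
      rw [incl_rightMul, incl_rightMul, incl_rightMul, mul_assoc])
  map_star' a := E.multiplier_ext
    (fun j => by
      change E.incl (E.leftMul (star a) j) = E.incl (star (E.rightMul a (star j)))
      rw [map_star, incl_leftMul, incl_rightMul, star_mul, map_star, star_star])
    (fun j => by
      change E.incl (E.rightMul (star a) j) = E.incl (star (E.leftMul a (star j)))
      rw [map_star, incl_leftMul, incl_rightMul, star_mul, map_star, star_star])

/-- The map `A → M(J)` extends the canonical embedding of `J`. -/
theorem toMultiplier_incl (j : J) :
    E.toMultiplier (E.incl j) = DoubleCentralizer.coeHom (𝕜 := ℂ) (A := J) j :=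
  E.multiplier_ext
    (fun k => by
      change E.incl (E.leftMul (E.incl j) k) = E.incl (j * k)
      rw [incl_leftMul, map_mul])
    (fun k => by
      change E.incl (E.rightMul (E.incl j) k) = E.incl (k * j)
      rw [incl_rightMul, map_mul])

theorem mk_toMultiplier_congr {a a' : A} (h : E.proj a = E.proj a') :
    Corona.mk J (E.toMultiplier a) = Corona.mk J (E.toMultiplier a') := by
  obtain ⟨j, hj⟩ := (E.exact (a - a')).1 (by rw [map_sub, h, sub_self])
  refine (Ideal.Quotient.mk_eq_mk_iff_sub_mem _ _).2 ⟨j, ?_⟩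
  rw [← map_sub, ← hj]
  exact (E.toMultiplier_incl j).symm

/-- The Busby invariant `β : B → Q(J)`: the ⋆-homomorphism sending the class of `a ∈ A` in
`B = A/J` to the class in `Q(J)` of the multiplier of `J` given by `a`. -/
noncomputable def busby : B →⋆ₙₐ[ℂ] Corona J where
  toFun b := Corona.mk J (E.toMultiplier (E.proj_surjective b).choose)
  map_smul' c b := by
    rw [E.mk_toMultiplier_congr (a' := c • (E.proj_surjective b).choose)
      (by rw [map_smul, (E.proj_surjective _).choose_spec, (E.proj_surjective _).choose_spec]),
      map_smul]
    rfl
  map_zero' := by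
    rw [E.mk_toMultiplier_congr (a' := 0)
      (by rw [map_zero, (E.proj_surjective _).choose_spec]), map_zero, map_zero]
  map_add' b c := by
    rw [E.mk_toMultiplier_congr
      (a' := (E.proj_surjective b).choose + (E.proj_surjective c).choose)
      (by rw [map_add, (E.proj_surjective _).choose_spec, (E.proj_surjective _).choose_spec,
        (E.proj_surjective _).choose_spec]), map_add, map_add]
  map_mul' b c := by
    rw [E.mk_toMultiplier_congr
      (a' := (E.proj_surjective b).choose * (E.proj_surjective c).choose)
      (by rw [map_mul, (E.proj_surjective _).choose_spec, (E.proj_surjective _).choose_spec,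
        (E.proj_surjective _).choose_spec]), map_mul, map_mul]
  map_star' b := by
    rw [E.mk_toMultiplier_congr (a' := star (E.proj_surjective b).choose)
      (by rw [map_star, (E.proj_surjective _).choose_spec, (E.proj_surjective _).choose_spec]),
      map_star, Corona.star_mk]

/-- The defining property of the Busby invariant. -/
theorem busby_proj (a : A) : E.busby (E.proj a) = Corona.mk J (E.toMultiplier a) :=
  E.mk_toMultiplier_congr (E.proj_surjective _).choose_spec

/-- An extension is full if `β b` is norm full in `Q(J)` for every non-zero `b ∈ B`. -/
def IsFull : Prop :=
  ∀ b : B, b ≠ 0 → IsFullSet {E.busby b}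

/-- An extension is purely large if for every `a ∈ A \ J` the hereditary subalgebra
`closure (a J a⋆)` contains a stable, σ-unital C⋆-subalgebra `D` that is full in `J`. (As
`closure (a J a⋆)` lies in the image of `J`, such a `D` is given as a subalgebra of `J`.) -/
def IsPurelyLarge : Prop :=
  ∀ a : A, a ∉ Set.range E.incl →
    ∃ (D : NonUnitalStarSubalgebra ℂ J) (hD : IsClosed (D : Set J)),
      letI : NonUnitalCStarAlgebra D :=
        NonUnitalStarSubalgebra.nonUnitalCStarAlgebra D (h_closed := hD)
      E.incl '' (D : Set J) ⊆ closure (Set.range fun j : J => a * E.incl j * star a) ∧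
        IsStable D ∧ IsSigmaUnital D ∧ IsFullSet (D : Set J)

end Busby

end CStarExtension

/-!
Write `T` for the multiplier `a⋆a` of `J`. It suffices to find `m ∈ M(J)` such that `V = a m` is an
isometry (`CStarExtension.exists_isometry`): then `D = V J V⋆` is contained in `a J a⋆`, it is
isomorphic to `J` and hence stable and σ-unital, and it is full because `V⋆ D V = J`.

The element `m` is found in three steps.

* *Algebra `B`.* For a non-zero positive `b ∈ B` there is a non-zero `x` with `x² = 0` in the ideal
  generated by `b` (`exists_sq_eq_zero_of_forall_character_eq_zero`). Otherwise the products
  `(h - t)₊ y (t - h)₊`, which square to zero, vanish for positive `h` in that ideal and all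
  `y ∈ B`; this forces `h` to be central, and a character of the centre of `B` then yields a
  character of `B`. Given `x`, the orthogonal elements `x⋆x` and `xx⋆` generate the same closed
  ideal, which contains `c = x⋆x + xx⋆`. By pure infiniteness, `c` is Cuntz subequivalent to (the
  cubes of) both of them, so that `c ⊕ c ≲ c`; also `c ≲ b`
  (`IsPurelyInfinite.exists_properlyInfinite`).
* *Corona algebra.* As `c` is properly infinite, the elements of `M(J)` that are Cuntz subequivalent
  to `c` modulo `J` are closed under addition. Fullness of the image of `c` writes `1` as a finite
  sum `∑ pᵢ c qᵢ` up to a small error, whence, with `b` the class of `T`, an inequality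
  `1 / 2 ≤ y⋆ T y + k` with `k ∈ J` (`exists_half_le_of_isFullSet`).
* *Stability.* The isometries `1 ⊗ sⁿ` of `M(J ⊗ 𝕂)`, for `s` the unilateral shift, compress `k` to an
  arbitrarily small element (`IsStable.exists_isometry_compress_lt`). So `(y s)⋆ T (y s)` is
  bounded below for a suitable isometry `s`, and normalizing `y s` by the inverse square root of this
  element gives `m`.
-/

/-! ### Commutation with a self-adjoint element -/

/-- If a self-adjoint `h` commutes with a commutator `z = [h, w]`, then `z = 0`. For the Cayley
transform `r` of `h`, which is unitary, `[r, w] = z'` commutes with `r` and is a unit multiple of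
`z`; so `[rⁿ, w] = n rⁿ⁻¹ z'` is bounded in `n`, which forces `z' = 0`. -/
theorem commutator_eq_zero_of_commute {M : Type*} [CStarAlgebra M] {h w z : M}
    (hh : IsSelfAdjoint h) (hz : h * w - w * h = z) (hc : Commute h z) : z = 0 := by
  have hspec : ∀ c : ℂ, c.im ≠ 0 → IsUnit (h - algebraMap ℂ M c) := by
    intro c hc
    have h1 : c ∉ spectrum ℂ h := fun hmem => by
      have := hh.mem_spectrum_eq_re hmem
      rw [this] at hc
      simp at hc
    have h2 := spectrum.notMem_iff.1 h1
    rw [← neg_sub]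
    exact h2.neg
  obtain ⟨a, ha⟩ := hspec (-Complex.I) (by simp)
  obtain ⟨b, hb⟩ := hspec Complex.I (by simp)
  rw [map_neg, sub_neg_eq_add] at ha
  set i : M := algebraMap ℂ M Complex.I with hi
  have hicomm : ∀ x : M, i * x = x * i := fun x => Algebra.commutes _ _
  have hcz : Commute (a : M) z := by rw [ha]; exact hc.add_left (hicomm z)
  have hcz' : Commute (↑a⁻¹ : M) z := hcz.units_inv_left
  -- The Cayley transform `(h - i) (h + i)⁻¹` of `h`.
  set r : M := 1 - (2 * i) * ↑a⁻¹ with hr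
  have hra : r * a = b := by
    rw [hr, sub_mul, mul_assoc, Units.inv_mul, ha, hb]; noncomm_ring
  have hab : (b : M) * a = a * b := by
    rw [ha, hb]; simp only [add_mul, mul_add, mul_sub, sub_mul, hicomm h]; abel
  have hrr : star r * r = 1 := by
    have h1 : star (b : M) = a := by
      rw [hb, ha, star_sub, hh.star_eq, hi, ← algebraMap_star_comm]; simp
    have h2 : star (a : M) = b := by rw [← h1, star_star]
    have h3 : star (a : M) * (star r * r) * a = star (a : M) * a := by
      calc star (a : M) * (star r * r) * a = star (r * a) * (r * a) := by
            rw [star_mul]; noncomm_ring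
        _ = _ := by rw [hra, h1, h2, hab]
    have h4 : IsUnit (star (a : M)) := a.isUnit.star
    have h5 := a.isUnit.mul_right_cancel h3
    exact h4.mul_left_cancel (by rw [h5, mul_one])
  have hnorm : ∀ n : ℕ, ∀ y : M, ‖r ^ n * y‖ = ‖y‖ := by
    have h1 : ∀ y : M, ‖r * y‖ = ‖y‖ := by
      intro y
      have h2 : ‖r * y‖ * ‖r * y‖ = ‖y‖ * ‖y‖ := by
        rw [← CStarRing.norm_star_mul_self, ← CStarRing.norm_star_mul_self (x := y), star_mul,
          mul_assoc, ← mul_assoc (star r), hrr, one_mul]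
      exact (mul_self_inj (norm_nonneg _) (norm_nonneg _)).1 h2
    intro n
    induction n with
    | zero => simp
    | succ n ih => intro y; rw [pow_succ, mul_assoc, ih, h1]
  have hnorm' : ∀ n : ℕ, ∀ y : M, ‖y * r ^ n‖ ≤ ‖y‖ := by
    intro n y
    refine (norm_mul_le _ _).trans ?_
    have h1 := hnorm n 1
    rw [mul_one] at h1
    rw [h1]
    rcases subsingleton_or_nontrivial M with hs | hs
    · rw [Subsingleton.elim y 0]; simp
    · rw [CStarRing.norm_one, mul_one]
  set z' : M := (2 * i) * (↑a⁻¹ * z * ↑a⁻¹) with hz'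
  have hinv : (↑a⁻¹ : M) * w - w * ↑a⁻¹ = -(↑a⁻¹ * z * ↑a⁻¹) := by
    have h1 : z = a * w - w * a := by
      rw [← hz, ha, add_mul, mul_add, hicomm w]; abel
    rw [h1, mul_sub, sub_mul, ← mul_assoc, Units.inv_mul, one_mul, mul_assoc (_ : M) (w * a),
      mul_assoc w, Units.mul_inv, mul_one]
    abel
  have hrw : r * w = w * r + z' := by
    have h1 : (2 * i) * (↑a⁻¹ * w) = w * ((2 * i) * ↑a⁻¹) - z' := by
      have h2 : (↑a⁻¹ : M) * w = w * ↑a⁻¹ - ↑a⁻¹ * z * ↑a⁻¹ := by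
        rw [sub_eq_add_neg, ← hinv]; abel
      rw [h2, mul_sub, hz', ← mul_assoc w, ← mul_assoc (2 * i) w]
      congr 2
      rw [mul_assoc, hicomm w, ← mul_assoc, ← mul_assoc, two_mul, mul_two]
    rw [hr, sub_mul, one_mul, mul_assoc, h1, mul_sub, mul_one]
    abel
  have hrz : Commute r z' := by
    have hr1 : Commute r (2 * i) := by
      refine (Commute.ofNat_right r 2).mul_right ?_
      exact (hicomm r).symm
    have hr2 : Commute r (↑a⁻¹ : M) := by
      rw [hr]
      refine (Commute.one_left _).sub_left (Commute.mul_left ?_ (Commute.refl _))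
      exact (Commute.ofNat_left 2 _).mul_left (hicomm _)
    have hr3 : Commute r z := by
      rw [hr]
      refine (Commute.one_left _).sub_left (Commute.mul_left ?_ hcz')
      exact (Commute.ofNat_left 2 _).mul_left (hicomm _)
    exact hr1.mul_right ((hr2.mul_right hr3).mul_right hr2)
  have hpow : ∀ n : ℕ, r ^ (n + 1) * w = w * r ^ (n + 1) + (n + 1 : ℕ) • (r ^ n * z') := by
    intro n
    induction n with
    | zero => simp [hrw]
    | succ n ih =>
      rw [pow_succ' r (n + 1), mul_assoc, ih, mul_add, ← mul_assoc r w, hrw, add_mul, mul_assoc w,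
        mul_smul_comm, ← mul_assoc r, ← pow_succ', ← pow_succ', add_assoc, ← (hrz.pow_left (n + 1)).eq,
        succ_nsmul' _ (n + 1)]
  have hbound : ∀ n : ℕ, (n + 1 : ℕ) * ‖z'‖ ≤ 2 * ‖w‖ := by
    intro n
    have h1 : (n + 1 : ℕ) • (r ^ n * z') = r ^ (n + 1) * w - w * r ^ (n + 1) := by
      rw [hpow n]; abel
    have h2 : ‖(n + 1 : ℕ) • (r ^ n * z')‖ = (n + 1 : ℕ) * ‖z'‖ := by
      rw [← Nat.cast_smul_eq_nsmul ℝ, norm_smul, hnorm, Real.norm_natCast]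
    rw [← h2, h1, two_mul]
    refine (norm_sub_le _ _).trans (add_le_add (hnorm _ _).le (hnorm' _ _))
  have hz0 : z' = 0 := by
    by_contra hne
    have hpos : 0 < ‖z'‖ := norm_pos_iff.2 hne
    obtain ⟨n, hn⟩ := exists_nat_gt (2 * ‖w‖ / ‖z'‖)
    rw [div_lt_iff₀ hpos] at hn
    have := hbound n
    push_cast at this
    nlinarith
  have h2i : IsUnit (2 * i) := by
    have : (2 * i : M) = algebraMap ℂ M (2 * Complex.I) := by
      rw [map_mul, map_ofNat]
    rw [this]
    exact (IsUnit.mk0 (2 * Complex.I) (by simp)).map (algebraMap ℂ M)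
  rw [hz'] at hz0
  have h1 := (h2i.mul_right_eq_zero).1 hz0
  have h2 := ((a⁻¹).isUnit.mul_left_eq_zero).1 h1
  exact ((a⁻¹).isUnit.mul_right_eq_zero).1 h2

open MeasureTheory in
/-- If `h ≥ 0` and `(h - t)₊ y (t - h)₊ = 0 = (t - h)₊ y (h - t)₊` for all `t > 0`, then `h` and `y`
commute. Indeed `(h - t)₊ y (h - t) = (h - t) y (h - t)₊`, and integrating over `t` gives
`[h, [h, [h, y]]] = 0`. -/
theorem commute_of_posPart_mul_mul_negPart_eq_zero {M : Type*} [CStarAlgebra M] [PartialOrder M]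
    [StarOrderedRing M] {h y : M} (hh : 0 ≤ h)
    (h₁ : ∀ t : ℝ, 0 < t → cfc (fun s => max (s - t) 0) h * y * cfc (fun s => max (t - s) 0) h = 0)
    (h₂ : ∀ t : ℝ, 0 < t → cfc (fun s => max (t - s) 0) h * y * cfc (fun s => max (s - t) 0) h = 0) :
    Commute h y := by
  have hsa : IsSelfAdjoint h := .of_nonneg hh
  set P : ℝ → M := fun t => cfc (fun s => max (s - t) 0) h with hP
  set m : ℝ := ‖h‖ with hm
  have hm0 : 0 ≤ m := norm_nonneg _
  have hspec : ∀ s ∈ spectrum ℝ h, 0 ≤ s ∧ s ≤ m := by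
    intro s hs
    rcases subsingleton_or_nontrivial M with h' | h'
    · simp at hs
    exact ⟨spectrum_nonneg_of_nonneg hh hs,
      (le_abs_self s).trans (spectrum.norm_le_norm_of_mem hs)⟩
  have key : ∀ t ∈ Set.Ioc 0 m, P t * y * h - (t • P t) * y = h * y * P t - y * (t • P t) := by
    intro t ht
    have h3 : P t - cfc (fun s => max (t - s) 0) h = h - algebraMap ℝ M t := by
      rw [hP, ← cfc_sub (fun s => max (s - t) 0) (fun s => max (t - s) 0) h]
      have : h - algebraMap ℝ M t = cfc (fun s : ℝ => s - t) h := by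
        rw [cfc_sub (fun s : ℝ => s) (fun _ => t) h, cfc_id' ℝ h, cfc_const t h]
      rw [this]
      congr 1
      ext s
      rcases le_total s t with hst | hst
      · rw [max_eq_right (by linarith), max_eq_left (by linarith)]; ring
      · rw [max_eq_left (by linarith), max_eq_right (by linarith)]; ring
    have h4 : h = P t - cfc (fun s => max (t - s) 0) h + algebraMap ℝ M t := by rw [h3]; abel
    have e1 : P t * y * h = P t * y * P t + t • (P t * y) := by
      conv_lhs => rw [h4]
      rw [mul_add, mul_sub, h₁ t ht.1, sub_zero, ← Algebra.commutes, Algebra.smul_def]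
    have e2 : h * y * P t = P t * y * P t + t • (y * P t) := by
      conv_lhs => rw [h4]
      rw [add_mul, add_mul, sub_mul, sub_mul, h₂ t ht.1, sub_zero, mul_assoc (algebraMap ℝ M t),
        Algebra.smul_def]
    rw [e1, e2, smul_mul_assoc, mul_smul_comm]; abel
  have hPint : IntegrableOn P (Set.Ioc 0 m) := by
    refine integrableOn_cfc measurableSet_Ioc (fun t s => max (s - t) 0) (fun _ => m) h
      (by fun_prop) ?_ ?_
    · refine (ae_restrict_iff' measurableSet_Ioc).2 (.of_forall fun t ht s hs => ?_)
      rw [Real.norm_of_nonneg (le_max_right _ _)]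
      have := hspec s hs
      exact max_le (by linarith [ht.1]) hm0
    · exact hasFiniteIntegral_const _
  have htP : ∀ t, t • P t = cfc (fun s => t * max (s - t) 0) h := by
    intro t
    rw [hP, ← cfc_const_mul t (fun s => max (s - t) 0) h, ]
  have htPint : IntegrableOn (fun t => t • P t) (Set.Ioc 0 m) := by
    simp_rw [htP]
    refine integrableOn_cfc measurableSet_Ioc (fun t s => t * max (s - t) 0) (fun _ => m * m) h
      (by fun_prop) ?_ ?_
    · refine (ae_restrict_iff' measurableSet_Ioc).2 (.of_forall fun t ht s hs => ?_)
      rw [Real.norm_of_nonneg (mul_nonneg ht.1.le (le_max_right _ _))]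
      have := hspec s hs
      exact mul_le_mul ht.2 (max_le (by linarith [ht.1]) hm0) (le_max_right _ _) hm0
    · exact hasFiniteIntegral_const _
  -- On the spectrum the integrals over `(0, m]` of the truncated functions end at `s`.
  have hcalc : ∀ s ∈ spectrum ℝ h, ∀ g : ℝ → ℝ, Continuous g →
      ∫ t in Set.Ioc 0 m, g t * max (s - t) 0 = ∫ t in (0 : ℝ)..s, g t * (s - t) := by
    intro s hs g hg
    have hs' := hspec s hs
    rw [← intervalIntegral.integral_of_le hm0, ← intervalIntegral.integral_add_adjacent_intervals
      (b := s) (Continuous.intervalIntegrable (by fun_prop) _ _)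
      (Continuous.intervalIntegrable (by fun_prop) _ _)]
    have e1 : ∫ t in s..m, g t * max (s - t) 0 = 0 := by
      rw [intervalIntegral.integral_congr (g := fun _ => 0)]
      · simp
      · intro t ht
        rw [Set.uIcc_of_le hs'.2] at ht
        simp only [max_eq_right (sub_nonpos.2 ht.1), mul_zero]
    rw [e1, add_zero]
    refine intervalIntegral.integral_congr fun t ht => ?_
    rw [Set.uIcc_of_le hs'.1] at ht
    simp only [max_eq_left (sub_nonneg.2 ht.2)]
  have hI1 : ∫ t in Set.Ioc 0 m, P t = (1 / 2 : ℝ) • h ^ 2 := by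
    rw [hP, ← cfc_setIntegral measurableSet_Ioc (fun t s => max (s - t) 0) (fun _ => m) h
      (by fun_prop) ?_ (hasFiniteIntegral_const _)]
    · rw [← cfc_pow_id (R := ℝ) h 2, ← cfc_smul (1 / 2 : ℝ) (fun s : ℝ => s ^ 2) h]
      refine cfc_congr fun s hs => ?_
      have := hcalc s hs (fun _ => 1) continuous_const
      simp only [one_mul] at this
      simp only [this]
      rw [intervalIntegral.integral_sub (by simp) (by simp)]
      simp
      ring
    · refine (ae_restrict_iff' measurableSet_Ioc).2 (.of_forall fun t ht s hs => ?_)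
      rw [Real.norm_of_nonneg (le_max_right _ _)]
      have := hspec s hs
      exact max_le (by linarith [ht.1]) hm0
  have hI2 : ∫ t in Set.Ioc 0 m, t • P t = (1 / 6 : ℝ) • h ^ 3 := by
    simp_rw [htP]
    rw [← cfc_setIntegral measurableSet_Ioc (fun t s => t * max (s - t) 0) (fun _ => m * m) h
      (by fun_prop) ?_ (hasFiniteIntegral_const _)]
    · rw [← cfc_pow_id (R := ℝ) h 3, ← cfc_smul (1 / 6 : ℝ) (fun s : ℝ => s ^ 3) h]
      refine cfc_congr fun s hs => ?_
      have := hcalc s hs (fun t => t) continuous_id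
      simp only [this]
      simp only [mul_sub]
      rw [intervalIntegral.integral_sub (Continuous.intervalIntegrable (by fun_prop) _ _)
        (Continuous.intervalIntegrable (by fun_prop) _ _)]
      have e2 : ∫ t in (0 : ℝ)..s, t * t = s ^ 3 / 3 := by
        simp_rw [← pow_two]; rw [integral_pow]; norm_num
      rw [e2, intervalIntegral.integral_mul_const, integral_id]
      simp
      ring
    · refine (ae_restrict_iff' measurableSet_Ioc).2 (.of_forall fun t ht s hs => ?_)
      rw [Real.norm_of_nonneg (mul_nonneg ht.1.le (le_max_right _ _))]
      have := hspec s hs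
      exact mul_le_mul ht.2 (max_le (by linarith [ht.1]) hm0) (le_max_right _ _) hm0
  have hint : (1 / 2 : ℝ) • h ^ 2 * y * h - (1 / 6 : ℝ) • h ^ 3 * y =
      h * y * (1 / 2 : ℝ) • h ^ 2 - y * (1 / 6 : ℝ) • h ^ 3 := by
    rw [← hI1, ← hI2, ← integral_mul_const_of_integrable hPint,
      ← integral_mul_const_of_integrable (hPint.mul_const y),
      ← integral_mul_const_of_integrable htPint, ← integral_const_mul_of_integrable hPint,
      ← integral_const_mul_of_integrable htPint, ← integral_sub, ← integral_sub]
    · exact setIntegral_congr_fun measurableSet_Ioc key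
    · exact hPint.const_mul _
    · exact htPint.const_mul _
    · exact (hPint.mul_const _).mul_const _
    · exact htPint.mul_const _
  have h3 : h ^ 3 * y - (3 : ℝ) • (h ^ 2 * y * h) + (3 : ℝ) • (h * y * h ^ 2) - y * h ^ 3 = 0 := by
    have := congrArg (fun x => (6 : ℝ) • x) hint
    simp only [smul_sub, smul_mul_assoc, mul_smul_comm, smul_smul] at this
    norm_num at this
    rw [sub_eq_iff_eq_add] at this
    rw [this]
    abel
  set w : M := h * y - y * h with hw
  set z : M := h * w - w * h with hz
  have hcz : Commute h z := by
    rw [commute_iff_eq, ← sub_eq_zero, hz, hw, ← h3]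
    simp only [show (3 : ℝ) = 1 + 1 + 1 by norm_num, add_smul, one_smul]
    noncomm_ring
  have hz0 : z = 0 := commutator_eq_zero_of_commute hsa hz.symm hcz
  have hw0 : w = 0 := commutator_eq_zero_of_commute hsa hw.symm (sub_eq_zero.1 (hz.symm.trans hz0))
  exact sub_eq_zero.1 (hw.symm.trans hw0)

/-! ### Square-zero elements and characters -/

theorem Unitization.exists_mul_inr_mul {B : Type*} [NonUnitalCStarAlgebra B]
    (u w : Unitization ℂ B) (v : B) : ∃ q : B, u * (v : Unitization ℂ B) * w = q :=
  ⟨(u * (v : Unitization ℂ B) * w).snd, Unitization.ext (by simp) (by simp)⟩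

/-- An ideal without non-zero square-zero elements has central positive elements: the products
`(h - t)₊ y (t - h)₊` of the preceding commutation criterion, formed in the unitization, are
square-zero elements of the ideal. -/
theorem commute_of_forall_sq_eq_zero {B : Type*} [NonUnitalCStarAlgebra B] [PartialOrder B]
    [StarOrderedRing B] {I : TwoSidedIdeal B} (hI : ∀ x ∈ I, x * x = 0 → x = 0) {h : B}
    (hh : 0 ≤ h) (hhI : h ∈ I) (v : B) : Commute h v := by
  have hsa : IsSelfAdjoint (h : Unitization ℂ B) := (IsSelfAdjoint.of_nonneg hh).inr ℂ
  -- `(h - t)₊` is a multiple of `h`, so that it lies in the ideal without taking limits.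
  have hcut : ∀ t : ℝ, 0 < t → ∃ G : Unitization ℂ B,
      cfc (fun s => max (s - t) 0) (h : Unitization ℂ B) = h * G ∧
      cfc (fun s => max (s - t) 0) (h : Unitization ℂ B) = G * h := by
    intro t ht
    have hcont : Continuous fun s : ℝ => max (s - t) 0 / max s t :=
      Continuous.div (by fun_prop) (by fun_prop) fun s => (lt_max_of_lt_right ht).ne'
    have hfun : ∀ s : ℝ, s * (max (s - t) 0 / max s t) = max (s - t) 0 := by
      intro s
      rcases le_total s t with hst | hst
      · rw [max_eq_right (sub_nonpos.2 hst)]; simp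
      · rw [max_eq_left (sub_nonneg.2 hst), max_eq_left hst]
        field_simp [(ht.trans_le hst).ne']
    have hG := cfc_mul (fun s : ℝ => s) _ (h : Unitization ℂ B) (by fun_prop) hcont.continuousOn
    have hG' := cfc_commute_cfc (fun s : ℝ => s) (fun s : ℝ => max (s - t) 0 / max s t)
      (h : Unitization ℂ B)
    simp only [hfun] at hG
    rw [cfc_id' ℝ (h : Unitization ℂ B)] at hG hG'
    exact ⟨_, hG, hG.trans hG'.eq⟩
  have hPN : ∀ t : ℝ, cfc (fun s => max (s - t) 0) (h : Unitization ℂ B) *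
      cfc (fun s => max (t - s) 0) (h : Unitization ℂ B) = 0 := by
    intro t
    rw [← cfc_mul _ _ (h : Unitization ℂ B)]
    have : (fun s : ℝ => max (s - t) 0 * max (t - s) 0) = fun _ => 0 := by
      ext s
      rcases le_total s t with hst | hst
      · rw [max_eq_right (sub_nonpos.2 hst)]; simp
      · rw [max_eq_right (sub_nonpos.2 hst)]; simp
    rw [this]; simp
  have hNP : ∀ t : ℝ, cfc (fun s => max (t - s) 0) (h : Unitization ℂ B) *
      cfc (fun s => max (s - t) 0) (h : Unitization ℂ B) = 0 := fun t => by
    rw [← hPN t]; exact cfc_commute_cfc _ _ _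
  have hc : Commute (h : Unitization ℂ B) (v : Unitization ℂ B) := by
    refine commute_of_posPart_mul_mul_negPart_eq_zero (Unitization.inr_nonneg_iff.2 hh) ?_ ?_
    · intro t ht
      obtain ⟨G, hG, -⟩ := hcut t ht
      set P := cfc (fun s => max (s - t) 0) (h : Unitization ℂ B)
      set N := cfc (fun s => max (t - s) 0) (h : Unitization ℂ B)
      obtain ⟨q, hq⟩ := Unitization.exists_mul_inr_mul G N v
      have h1 : P * v * N = ((h * q : B) : Unitization ℂ B) := by
        rw [Unitization.inr_mul, ← hq, hG]; noncomm_ring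
      have h2 : (h * q) * (h * q) = 0 := by
        apply Unitization.inr_injective (R := ℂ)
        rw [Unitization.inr_mul, ← h1, Unitization.inr_zero]
        calc P * v * N * (P * v * N) = P * v * (N * P) * v * N := by noncomm_ring
          _ = 0 := by rw [hNP]; simp
      rw [h1, hI _ (I.mul_mem_right _ _ hhI) h2, Unitization.inr_zero]
    · intro t ht
      obtain ⟨G, -, hG⟩ := hcut t ht
      set P := cfc (fun s => max (s - t) 0) (h : Unitization ℂ B)
      set N := cfc (fun s => max (t - s) 0) (h : Unitization ℂ B)
      obtain ⟨q, hq⟩ := Unitization.exists_mul_inr_mul N G v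
      have h1 : N * v * P = ((q * h : B) : Unitization ℂ B) := by
        rw [Unitization.inr_mul, ← hq, hG]; noncomm_ring
      have h2 : (q * h) * (q * h) = 0 := by
        apply Unitization.inr_injective (R := ℂ)
        rw [Unitization.inr_mul, ← h1, Unitization.inr_zero]
        calc N * v * P * (N * v * P) = N * v * (P * N) * v * P := by noncomm_ring
          _ = 0 := by rw [hPN]; simp
      rw [h1, hI _ (I.mul_mem_left _ _ hhI) h2, Unitization.inr_zero]
  apply Unitization.inr_injective (R := ℂ)
  simpa only [Unitization.inr_mul] using hc.eq

theorem exists_starHom_apply_ne_zero {C : Type*} [NonUnitalCommCStarAlgebra C] {z : C}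
    (hz : z ≠ 0) : ∃ φ : C →⋆ₙₐ[ℂ] ℂ, φ z ≠ 0 := by
  have h1 : (z : Unitization ℂ C) ≠ 0 := fun h => hz (Unitization.inr_injective (R := ℂ) h)
  have h2 : WeakDual.gelfandTransform ℂ (Unitization ℂ C) z ≠ 0 := fun h =>
    h1 ((gelfandTransform_isometry (Unitization ℂ C)).injective (h.trans (map_zero _).symm))
  obtain ⟨φ, hφ⟩ := DFunLike.ne_iff.1 h2
  refine ⟨(StarAlgHomClass.toStarAlgHom φ : Unitization ℂ C →⋆ₐ[ℂ] ℂ).toNonUnitalStarAlgHom.comp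
    (Unitization.inrNonUnitalStarAlgHom ℂ C), hφ⟩

/-- In a C⋆-algebra without characters, every ideal generated by a non-zero positive element
contains a non-zero element of square zero. -/
theorem exists_sq_eq_zero_of_forall_character_eq_zero {B : Type*} [NonUnitalCStarAlgebra B]
    (hχ : ∀ χ : B →⋆ₙₐ[ℂ] ℂ, χ = 0) {b : B} (hb : b ∈ positiveCone B) (hb0 : b ≠ 0) :
    ∃ x ∈ TwoSidedIdeal.span {b}, x * x = 0 ∧ x ≠ 0 := by
  let _ : PartialOrder B := CStarAlgebra.spectralOrder B
  have : StarOrderedRing B := CStarAlgebra.spectralOrderedRing B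
  by_contra! hcon
  have hbI : b ∈ TwoSidedIdeal.span {b} := TwoSidedIdeal.subset_span rfl
  have hbsa : IsSelfAdjoint b := by
    obtain ⟨z, rfl⟩ := hb
    exact .star_mul_self z
  have hcomm : ∀ y v : B, Commute (b * y * b) v := by
    intro y v
    have hy : y ∈ Submodule.span ℂ {a : B | 0 ≤ a} := by
      rw [CStarAlgebra.span_nonneg]; trivial
    induction hy using Submodule.span_induction with
    | mem y hy =>
      refine commute_of_forall_sq_eq_zero hcon ?_
        (TwoSidedIdeal.mul_mem_left _ _ _ hbI) v
      have := star_left_conjugate_nonneg (show 0 ≤ y from hy) b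
      rwa [hbsa.star_eq] at this
    | zero => simp
    | add x y _ _ hx hy => rw [mul_add, add_mul]; exact hx.add_left hy
    | smul c x _ hx => rw [mul_smul_comm, smul_mul_assoc]; exact hx.smul_left c
  let Z : NonUnitalStarSubalgebra ℂ B := NonUnitalStarSubalgebra.center ℂ B
  have hZmem : ∀ y : B, b * y * b ∈ Z := fun y =>
    NonUnitalStarSubalgebra.mem_center_iff.2 fun v => (hcomm y v).symm.eq
  have hZcl : IsClosed (Z : Set B) := by
    have : (Z : Set B) = ⋂ v : B, {z | v * z = z * v} := by
      ext z
      simp [Z, NonUnitalStarSubalgebra.mem_center_iff]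
    rw [this]
    exact isClosed_iInter fun v => isClosed_eq (by fun_prop) (by fun_prop)
  let i₁ : NonUnitalCStarAlgebra Z :=
    NonUnitalStarSubalgebra.nonUnitalCStarAlgebra Z (h_closed := hZcl)
  let i₂ : NonUnitalCommCStarAlgebra Z :=
    { i₁ with mul_comm := fun x y =>
        Subtype.ext <| NonUnitalStarSubalgebra.mem_center_iff.1 y.2 (x : B) }
  -- With `c = b³`, all elements `c y c` are central; compressing by `c` and applying a character
  -- of the centre defines the character `χ` of `B`.
  set c : B := b * b * b with hc
  have hcsa : star c = c := by rw [hc]; simp [hbsa.star_eq, mul_assoc]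
  have hF : ∀ y : B, c * y * c ∈ Z := fun y => by
    have : c * y * c = b * (b * b * y * b * b) * b := by rw [hc]; noncomm_ring
    rw [this]; exact hZmem _
  have hcc : c * c ∈ Z := by
    have : c * c = b * (b * b * b * b) * b := by rw [hc]; noncomm_ring
    rw [this]; exact hZmem _
  have hsq : ∀ x : B, IsSelfAdjoint x → x * x = 0 → x = 0 := fun x hx h =>
    (CStarRing.star_mul_self_eq_zero_iff x).1 (by rw [hx.star_eq, h])
  have hcc0 : c * c ≠ 0 := by
    intro h
    have h1 : c = 0 := hsq c hcsa h
    have h2 : (b * b) * (b * b) = 0 := by rw [← mul_assoc, ← hc, h1, zero_mul]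
    exact hb0 (hsq b hbsa (hsq (b * b) (by simp [IsSelfAdjoint, hbsa.star_eq]) h2))
  obtain ⟨φ, hφ⟩ := exists_starHom_apply_ne_zero (C := Z) (z := ⟨c * c, hcc⟩)
    (fun h => hcc0 (congrArg Subtype.val h))
  set d : ℂ := φ ⟨c * c, hcc⟩ with hd
  have hcomm' : ∀ v : B, Commute c v := fun v => hcomm b v
  have hdstar : star d = d := by
    rw [hd, ← map_star]; congr 1; ext; simp [hcsa]
  let χ : B →⋆ₙₐ[ℂ] ℂ :=
    { toFun := fun y => d⁻¹ * φ ⟨c * y * c, hF y⟩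
      map_smul' := fun k y => by
        have : (⟨c * (k • y) * c, hF _⟩ : Z) = k • ⟨c * y * c, hF y⟩ :=
          Subtype.ext (by change c * (k • y) * c = k • (c * y * c); rw [mul_smul_comm, smul_mul_assoc])
        rw [this, map_smul]; simp; ring
      map_zero' := by
        have : (⟨c * 0 * c, hF 0⟩ : Z) = 0 := by ext; simp
        rw [this, map_zero, mul_zero]
      map_add' := fun y z => by
        have : (⟨c * (y + z) * c, hF _⟩ : Z) = ⟨c * y * c, hF y⟩ + ⟨c * z * c, hF z⟩ := by
          ext; simp [mul_add, add_mul]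
        rw [this, map_add, mul_add]
      map_mul' := fun y z => by
        have : (⟨c * (y * z) * c, hF _⟩ : Z) * ⟨c * c, hcc⟩ =
            ⟨c * y * c, hF y⟩ * ⟨c * z * c, hF z⟩ := by
          ext
          change c * (y * z) * c * (c * c) = c * y * c * (c * z * c)
          have e := (hcomm' z).eq
          calc c * (y * z) * c * (c * c) = c * y * (z * c) * c * c := by noncomm_ring
            _ = c * y * (c * z) * c * c := by rw [e]
            _ = c * y * c * (z * c) * c := by noncomm_ring
            _ = c * y * c * (c * z) * c := by rw [e]
            _ = c * y * c * (c * z * c) := by noncomm_ring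
        have h2 := congrArg φ this
        rw [map_mul, map_mul, ← hd] at h2
        field_simp
        linear_combination h2
      map_star' := fun y => by
        have : (⟨c * star y * c, hF _⟩ : Z) = star ⟨c * y * c, hF y⟩ := by
          ext; simp [hcsa, mul_assoc]
        rw [this, map_star, star_mul', star_inv₀, hdstar] }
  have h0 : χ (c * c) = 0 := by rw [hχ χ]; rfl
  have h1 : χ (c * c) = d := by
    change d⁻¹ * φ ⟨c * (c * c) * c, hF _⟩ = d
    have : (⟨c * (c * c) * c, hF (c * c)⟩ : Z) = ⟨c * c, hcc⟩ * ⟨c * c, hcc⟩ := by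
      ext; change c * (c * c) * c = c * c * (c * c); noncomm_ring
    rw [this, map_mul, ← hd]
    field_simp
  exact hφ (h1.symm.trans h0)

/-! ### Properly infinite elements -/

section closedIdealSpan

variable {R : Type*} [NonUnitalRing R] [TopologicalSpace R] {S : Set R} {x y : R}

theorem subset_closedIdealSpan (hx : x ∈ TwoSidedIdeal.span S) : x ∈ closedIdealSpan S :=
  subset_closure hx

theorem add_mem_closedIdealSpan [ContinuousAdd R] (hx : x ∈ closedIdealSpan S)
    (hy : y ∈ closedIdealSpan S) : x + y ∈ closedIdealSpan S :=
  map_mem_closure₂ continuous_add hx hy fun _ ha _ hb => TwoSidedIdeal.add_mem _ ha hb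

theorem mul_mem_closedIdealSpan_left [ContinuousMul R] (r : R) (hx : x ∈ closedIdealSpan S) :
    r * x ∈ closedIdealSpan S :=
  map_mem_closure (continuous_const_mul r) hx fun _ ha => TwoSidedIdeal.mul_mem_left _ _ _ ha

theorem mul_mem_closedIdealSpan_right [ContinuousMul R] (r : R) (hx : x ∈ closedIdealSpan S) :
    x * r ∈ closedIdealSpan S :=
  map_mem_closure (f := (· * r)) (continuous_mul_const r) hx fun _ ha => TwoSidedIdeal.mul_mem_right _ _ _ ha

end closedIdealSpan

/-- Closed ideals of C⋆-algebras are semiprime: `x * (x⋆x) * k(x⋆x)` approximates `x` for a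
suitable function `k`. -/
theorem mem_closedIdealSpan_of_star_mul_self_mem {B : Type*} [NonUnitalCStarAlgebra B] {S : Set B}
    {x : B} (hx : star x * x ∈ closedIdealSpan S) : x ∈ closedIdealSpan S := by
  let _ : PartialOrder B := CStarAlgebra.spectralOrder B
  have : StarOrderedRing B := CStarAlgebra.spectralOrderedRing B
  have hcl : IsClosed (closedIdealSpan S) := isClosed_closure
  rw [← hcl.closure_eq, Metric.mem_closure_iff]
  intro ε hε
  set e : B := star x * x with he
  have he0 : 0 ≤ e := star_mul_self_nonneg x
  have hesa : IsSelfAdjoint e := .of_nonneg he0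
  -- `x - x q` has square norm at most `sup s (1 - s k(s))² ≤ δ`, where `s k(s) = s² / (s + δ)²`;
  -- the absolute values only make the functions continuous on the whole line.
  set δ : ℝ := ε ^ 2 / 2 with hδ
  have hδ0 : 0 < δ := by positivity
  have hpos : ∀ s : ℝ, (|s| + δ) ^ 2 ≠ 0 := fun s => by positivity
  set k : ℝ → ℝ := fun s => |s| / (|s| + δ) ^ 2 with hk
  have hkc : Continuous k := Continuous.div (by fun_prop) (by fun_prop) hpos
  set f : ℝ → ℝ := fun s => s * k s with hf
  have hfc : Continuous f := by fun_prop
  have hk0 : k 0 = 0 := by simp [hk]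
  have hf0 : f 0 = 0 := by simp [hf]
  set q : B := cfcₙ f e with hq
  have hqk : q = e * cfcₙ k e := by
    rw [hq, hf, cfcₙ_mul (fun s : ℝ => s) k e (by fun_prop) rfl hkc.continuousOn hk0,
      cfcₙ_id' ℝ e]
  have hqsa : star q = q := (cfcₙ_predicate f e : IsSelfAdjoint q).star_eq
  have hval : star (x - x * q) * (x - x * q) =
      cfcₙ (fun s => s - f s * s - s * f s + f s * s * f s) e := by
    have h1 : star (x - x * q) * (x - x * q) = e - q * e - e * q + q * e * q := by
      rw [star_sub, star_mul, hqsa, he]; noncomm_ring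
    rw [cfcₙ_add (fun s => s - f s * s - s * f s) (fun s => f s * s * f s) e
        (by fun_prop) (by simp [hf0]) (by fun_prop) (by simp [hf0]),
      cfcₙ_sub (fun s => s - f s * s) (fun s => s * f s) e
        (by fun_prop) (by simp [hf0]) (by fun_prop) (by simp [hf0]),
      cfcₙ_sub (fun s => s) (fun s => f s * s) e
        (by fun_prop) (by simp) (by fun_prop) (by simp),
      cfcₙ_mul (fun s => f s * s) f e
        (by fun_prop) (by simp) (by fun_prop) hf0,
      cfcₙ_mul f (fun s => s) e (by fun_prop) hf0 (by fun_prop) rfl,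
      cfcₙ_mul (fun s => s) f e (by fun_prop) rfl (by fun_prop) hf0, cfcₙ_id' ℝ e, h1]
  have hnorm : ‖x - x * q‖ * ‖x - x * q‖ ≤ δ := by
    rw [← CStarRing.norm_star_mul_self, hval]
    refine norm_cfcₙ_le fun s hs => ?_
    have hs0 : 0 ≤ s := quasispectrum_nonneg_of_nonneg e he0 s hs
    have hsd : 0 < s + δ := by linarith
    have hval : s - f s * s - s * f s + f s * s * f s =
        s * δ ^ 2 * (2 * s + δ) ^ 2 / (s + δ) ^ 4 := by
      simp only [hf, hk, abs_of_nonneg hs0]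
      field_simp
      ring
    rw [hval, Real.norm_of_nonneg (by positivity), div_le_iff₀ (by positivity)]
    have h1 : (2 * s + δ) ^ 2 ≤ 4 * (s + δ) ^ 2 := by nlinarith
    have h2 : 4 * s * δ ≤ (s + δ) ^ 2 := by nlinarith [sq_nonneg (s - δ)]
    calc s * δ ^ 2 * (2 * s + δ) ^ 2 ≤ s * δ ^ 2 * (4 * (s + δ) ^ 2) := by gcongr
      _ = δ * (4 * s * δ) * (s + δ) ^ 2 := by ring
      _ ≤ δ * (s + δ) ^ 2 * (s + δ) ^ 2 := by gcongr
      _ = δ * (s + δ) ^ 4 := by ring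
  refine ⟨x * q, ?_, ?_⟩
  · rw [hqk]
    exact mul_mem_closedIdealSpan_left _ (mul_mem_closedIdealSpan_right _ hx)
  · rw [dist_eq_norm]
    have h1 : δ < ε ^ 2 := by rw [hδ]; linarith [pow_pos hε 2]
    nlinarith [norm_nonneg (x - x * q)]

theorem mem_closedIdealSpan_of_star_mul_self_pow_three {B : Type*} [NonUnitalCStarAlgebra B]
    (x : B) :
    x ∈ closedIdealSpan {star x * x * (star x * x) * (star x * x)} := by
  set e : B := star x * x with he
  have hesa : star e = e := by rw [he]; simp
  refine mem_closedIdealSpan_of_star_mul_self_mem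
    (mem_closedIdealSpan_of_star_mul_self_mem (x := e) ?_)
  rw [hesa]
  refine mem_closedIdealSpan_of_star_mul_self_mem ?_
  have : star (e * e) * (e * e) = e * e * e * e := by rw [star_mul, hesa]; noncomm_ring
  rw [this]
  exact mul_mem_closedIdealSpan_right _ (subset_closedIdealSpan (TwoSidedIdeal.subset_span rfl))

theorem CuntzLE.exists_norm_sub_lt {B : Type*} [NonUnitalCStarAlgebra B] {a b : B}
    (h : CuntzLE a b) {ε : ℝ} (hε : 0 < ε) : ∃ r : B, ‖star r * b * r - a‖ < ε := by
  obtain ⟨r, hr⟩ := h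
  obtain ⟨n, hn⟩ := (Metric.tendsto_atTop.1 hr) ε hε
  exact ⟨r n, by simpa only [dist_eq_norm] using hn n le_rfl⟩

/-- Below every non-zero positive element `b` of a purely infinite C⋆-algebra lies a non-zero positive
element `c` with `c ⊕ c ≲ c`, namely `c = x⋆x + xx⋆` for a square-zero element `x`. -/
theorem IsPurelyInfinite.exists_properlyInfinite {B : Type*} [NonUnitalCStarAlgebra B]
    (hB : IsPurelyInfinite B) {b : B} (hb : b ∈ positiveCone B) (hb0 : b ≠ 0) :
    ∃ c : B, c ≠ 0 ∧ CuntzLE c b ∧ (∃ z, c = star z * z) ∧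
      ∀ ε > 0, ∃ r s : B, ‖star r * c * r - c‖ < ε ∧ ‖star s * c * s - c‖ < ε ∧
        star r * c * s = 0 := by
  obtain ⟨x, hxb, hxx, hx0⟩ := exists_sq_eq_zero_of_forall_character_eq_zero hB.1 hb hb0
  set e : B := star x * x with he
  set f : B := x * star x with hf
  have hesa : star e = e := by rw [he]; simp
  have hfsa : star f = f := by rw [hf]; simp
  have hxx' : star x * star x = 0 := by rw [← star_mul, hxx, star_zero]
  have hef : e * f = 0 := by
    rw [he, hf, mul_assoc, ← mul_assoc x, hxx, zero_mul, mul_zero]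
  have hfe : f * e = 0 := by
    rw [he, hf, mul_assoc, ← mul_assoc (star x), hxx', zero_mul, mul_zero]
  have hc : e + f = star (x + star x) * (x + star x) := by
    rw [star_add, star_star, add_mul, mul_add, mul_add, hxx, hxx', add_zero, zero_add]
  have hcpos : e + f ∈ positiveCone B := ⟨_, hc⟩
  have hmem : ∀ S : Set B, x ∈ closedIdealSpan S → e + f ∈ closedIdealSpan S := fun S hS =>
    add_mem_closedIdealSpan (mul_mem_closedIdealSpan_left _ hS)
      (mul_mem_closedIdealSpan_right _ hS)
  have hmem' : ∀ S : Set B, star x ∈ closedIdealSpan S → e + f ∈ closedIdealSpan S := fun S hS =>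
    add_mem_closedIdealSpan (mul_mem_closedIdealSpan_right _ hS)
      (mul_mem_closedIdealSpan_left _ hS)
  -- Comparing with cubes leaves a factor to place on each side, which makes the cross terms vanish.
  have he3 : CuntzLE (e + f) (e * e * e) := by
    refine hB.2 _ hcpos _ ⟨x * e, ?_⟩ (hmem _ (mem_closedIdealSpan_of_star_mul_self_pow_three x))
    rw [star_mul, hesa, he]; noncomm_ring
  have hf3 : CuntzLE (e + f) (f * f * f) := by
    refine hB.2 _ hcpos _ ⟨star x * f, ?_⟩ (hmem' _ ?_)
    · rw [star_mul, hfsa, star_star, hf]; noncomm_ring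
    · simpa only [star_star] using mem_closedIdealSpan_of_star_mul_self_pow_three (star x)
  refine ⟨e + f, ?_, hB.2 _ hcpos _ hb (hmem _ (subset_closedIdealSpan hxb)), ⟨_, hc⟩, ?_⟩
  · intro h
    rw [hc, CStarRing.star_mul_self_eq_zero_iff] at h
    apply hx0
    rw [← CStarRing.star_mul_self_eq_zero_iff, eq_neg_of_add_eq_zero_right h, neg_mul, hxx,
      neg_zero]
  · intro ε hε
    obtain ⟨r, hr⟩ := he3.exists_norm_sub_lt hε
    obtain ⟨s, hs⟩ := hf3.exists_norm_sub_lt hε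
    refine ⟨e * r, f * s, ?_, ?_, ?_⟩
    · convert hr using 3
      rw [star_mul, hesa]
      calc star r * e * (e + f) * (e * r) = star r * (e * e * e) * r + star r * e * (f * e) * r := by
            noncomm_ring
        _ = _ := by rw [hfe]; simp
    · convert hs using 3
      rw [star_mul, hfsa]
      calc star s * f * (e + f) * (f * s) = star s * (f * e) * f * s + star s * (f * f * f) * s := by
            noncomm_ring
        _ = _ := by rw [hfe]; simp
    · rw [star_mul, hesa]
      calc star r * e * (e + f) * (f * s) = star r * e * (e * f) * s + star r * (e * f) * f * s := by
            noncomm_ring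
        _ = _ := by rw [hef]; simp

/-! ### Comparison in the multiplier algebra modulo the ideal -/

section OrderUnit

variable {M : Type*} [CStarAlgebra M] [PartialOrder M] [StarOrderedRing M]

theorem algebraMap_one_le_add_star_of_norm_sub_one_lt {X : M} (hX : ‖X - 1‖ < 1 / 2) :
    algebraMap ℝ M 1 ≤ X + star X := by
  have hD : IsSelfAdjoint (-((X - 1) + star (X - 1))) := (IsSelfAdjoint.add_star_self _).neg
  have hn : ‖-((X - 1) + star (X - 1))‖ ≤ 1 := by
    rw [norm_neg]
    refine (norm_add_le _ _).trans ?_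
    rw [norm_star]; linarith
  have h4 := hD.le_algebraMap_norm_self.trans (algebraMap_mono M hn)
  rw [map_one] at h4 ⊢
  rw [← sub_nonneg] at h4 ⊢
  convert h4 using 1
  rw [star_sub, star_one]; abel

/-- If `1 ≤ S + k` and `S` is within `1 / 2` of `Y + l` with `Y` self-adjoint, then `1 / 2` is at
most the sum of `Y` and the real part of `k + l`. -/
theorem algebraMap_half_le_of_norm_sub_lt {S Y k l : M} (hle : algebraMap ℝ M 1 ≤ S + k)
    (hY : IsSelfAdjoint Y) (hS : ‖S - Y - l‖ < 1 / 2) :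
    algebraMap ℝ M (1 / 2) ≤ Y + (1 / 2 : ℝ) • ((k + l) + star (k + l)) := by
  have hSk : IsSelfAdjoint (S + k) := by
    rw [← sub_add_cancel (S + k) (algebraMap ℝ M 1)]
    exact (IsSelfAdjoint.of_nonneg (sub_nonneg.2 hle)).add (.algebraMap M (.all _))
  set D := S - Y - l with hDdef
  set D' : M := (1 / 2 : ℝ) • (D + star D) with hD'
  have hD'sa : IsSelfAdjoint D' := (IsSelfAdjoint.all _).smul (.add_star_self _)
  have hD'n : ‖D'‖ ≤ 1 / 2 := by
    rw [hD', norm_smul]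
    have := norm_add_le D (star D)
    rw [norm_star] at this
    norm_num
    linarith
  have hdec : S + k = Y + (1 / 2 : ℝ) • ((k + l) + star (k + l)) + D' := by
    have e1 : S + k = (1 / 2 : ℝ) • ((S + k) + star (S + k)) := by
      rw [hSk.star_eq, ← two_smul ℝ, smul_smul]; norm_num
    have e2 : Y = (1 / 2 : ℝ) • (Y + star Y) := by
      rw [hY.star_eq, ← two_smul ℝ, smul_smul]; norm_num
    rw [e1]
    nth_rw 1 [e2]
    rw [hD', ← smul_add, ← smul_add, hDdef]
    congr 1
    simp only [star_add, star_sub]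
    abel
  rw [hdec] at hle
  have hfin := hle.trans (add_le_add_right
    (hD'sa.le_algebraMap_norm_self.trans (algebraMap_mono M hD'n)) _)
  have e : algebraMap ℝ M 1 = algebraMap ℝ M (1 / 2) + algebraMap ℝ M (1 / 2) := by
    rw [← map_add]; norm_num
  rw [e] at hfin
  exact le_of_add_le_add_right hfin

end OrderUnit

section CuntzCone

variable {J : Type*} [NonUnitalCStarAlgebra J]

/-- The multipliers of `J` whose class in the corona algebra is Cuntz subequivalent to that
of `T`. The approximation is phrased in `M(J)`, up to an error term in `J`. -/
def cuntzCone (T : 𝓜(ℂ, J)) : Set 𝓜(ℂ, J) :=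
  {S | ∀ ε > 0, ∃ y : 𝓜(ℂ, J), ∃ k ∈ coronaIdeal J, ‖S - star y * T * y - k‖ < ε}

theorem star_mul_mul_mem_coronaIdeal (y z : 𝓜(ℂ, J)) {k : 𝓜(ℂ, J)} (hk : k ∈ coronaIdeal J) :
    y * k * z ∈ coronaIdeal J :=
  Ideal.mul_mem_right _ _ (Ideal.mul_mem_left _ _ hk)

theorem norm_conjugate_le (y D : 𝓜(ℂ, J)) : ‖star y * D * y‖ ≤ ‖y‖ ^ 2 * ‖D‖ := by
  refine (norm_mul_le _ _).trans ?_
  have := norm_mul_le (star y) D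
  rw [norm_star] at this
  nlinarith [norm_nonneg y]

theorem star_mul_mul_mem_cuntzCone (T x : 𝓜(ℂ, J)) : star x * T * x ∈ cuntzCone T :=
  fun ε hε => ⟨x, 0, Submodule.zero_mem _, by simpa using hε⟩

theorem cuntzCone_trans {T G S : 𝓜(ℂ, J)} (hG : G ∈ cuntzCone T) (hS : S ∈ cuntzCone G) :
    S ∈ cuntzCone T := by
  intro ε hε
  obtain ⟨y, k, hk, hy⟩ := hS (ε / 2) (by positivity)
  have hpos : 0 < 1 + ‖y‖ ^ 2 := by positivity
  obtain ⟨t, l, hl, ht⟩ := hG (ε / 2 / (1 + ‖y‖ ^ 2)) (by positivity)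
  refine ⟨t * y, k + star y * l * y, add_mem hk (star_mul_mul_mem_coronaIdeal _ _ hl), ?_⟩
  have h1 : S - star (t * y) * T * (t * y) - (k + star y * l * y) =
      (S - star y * G * y - k) + star y * (G - star t * T * t - l) * y := by
    rw [star_mul]; noncomm_ring
  rw [h1]
  refine (norm_add_le _ _).trans_lt ?_
  have h2 := norm_conjugate_le y (G - star t * T * t - l)
  rw [lt_div_iff₀ hpos] at ht
  nlinarith [norm_nonneg (G - star t * T * t - l)]

/-- Proper infiniteness of `G` modulo `J` makes the elements below `G` closed under addition. -/
theorem add_mem_cuntzCone {G S₁ S₂ : 𝓜(ℂ, J)} (hGsa : IsSelfAdjoint G)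
    (hG : ∀ ε > 0, ∃ r s : 𝓜(ℂ, J), (∃ k ∈ coronaIdeal J, ‖star r * G * r - G - k‖ < ε) ∧
      (∃ k ∈ coronaIdeal J, ‖star s * G * s - G - k‖ < ε) ∧ star r * G * s ∈ coronaIdeal J)
    (h₁ : S₁ ∈ cuntzCone G) (h₂ : S₂ ∈ cuntzCone G) : S₁ + S₂ ∈ cuntzCone G := by
  intro ε hε
  obtain ⟨y, k, hk, hy⟩ := h₁ (ε / 4) (by positivity)
  obtain ⟨z, l, hl, hz⟩ := h₂ (ε / 4) (by positivity)
  have hpos : 0 < 1 + ‖y‖ ^ 2 + ‖z‖ ^ 2 := by positivity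
  obtain ⟨r, s, ⟨kr, hkr, hr⟩, ⟨ks, hks, hs⟩, hrs⟩ :=
    hG (ε / 4 / (1 + ‖y‖ ^ 2 + ‖z‖ ^ 2)) (by positivity)
  have hsr : star s * G * r ∈ coronaIdeal J := by
    have := coronaIdeal_star_mem J hrs
    rwa [star_mul, star_mul, star_star, hGsa.star_eq, ← mul_assoc] at this
  refine ⟨r * y + s * z, k + l - star y * kr * y - star z * ks * z
    - star y * (star r * G * s) * z - star z * (star s * G * r) * y, ?_, ?_⟩
  · exact sub_mem (sub_mem (sub_mem (sub_mem (add_mem hk hl)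
      (star_mul_mul_mem_coronaIdeal _ _ hkr)) (star_mul_mul_mem_coronaIdeal _ _ hks))
      (star_mul_mul_mem_coronaIdeal _ _ hrs)) (star_mul_mul_mem_coronaIdeal _ _ hsr)
  have h1 : S₁ + S₂ - star (r * y + s * z) * G * (r * y + s * z) -
      (k + l - star y * kr * y - star z * ks * z
        - star y * (star r * G * s) * z - star z * (star s * G * r) * y) =
      ((S₁ - star y * G * y - k) + (S₂ - star z * G * z - l)) -
      (star y * (star r * G * r - G - kr) * y + star z * (star s * G * s - G - ks) * z) := by
    rw [star_add, star_mul, star_mul]; noncomm_ring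
  rw [h1]
  refine (norm_sub_le _ _).trans_lt ?_
  have e1 := norm_add_le (S₁ - star y * G * y - k) (S₂ - star z * G * z - l)
  have e2 := norm_add_le (star y * (star r * G * r - G - kr) * y)
    (star z * (star s * G * s - G - ks) * z)
  have e3 := norm_conjugate_le y (star r * G * r - G - kr)
  have e4 := norm_conjugate_le z (star s * G * s - G - ks)
  rw [lt_div_iff₀ hpos] at hr hs
  have n1 := norm_nonneg (star r * G * r - G - kr)
  have n2 := norm_nonneg (star s * G * s - G - ks)
  have p1 := mul_nonneg n1 (sq_nonneg ‖z‖)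
  have p2 := mul_nonneg n2 (sq_nonneg ‖y‖)
  nlinarith

variable [PartialOrder 𝓜(ℂ, J)] [StarOrderedRing 𝓜(ℂ, J)]

/-- The real part of an element of the ideal generated by `G` modulo `J` is dominated by an element
below `G`, since `p G q + (p G q)⋆ ≤ p G p⋆ + q⋆ G q`. -/
theorem exists_add_star_le_of_mk_mem_span {G Z : 𝓜(ℂ, J)} (hGZ : G = star Z * Z)
    (hG : ∀ ε > 0, ∃ r s : 𝓜(ℂ, J), (∃ k ∈ coronaIdeal J, ‖star r * G * r - G - k‖ < ε) ∧
      (∃ k ∈ coronaIdeal J, ‖star s * G * s - G - k‖ < ε) ∧ star r * G * s ∈ coronaIdeal J)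
    {q : Corona J} (hq : q ∈ TwoSidedIdeal.span {Corona.mk J G}) :
    ∀ X : 𝓜(ℂ, J), Corona.mk J X = q →
      (∃ S ∈ cuntzCone G, ∃ k ∈ coronaIdeal J, X + star X ≤ S + k) := by
  have hGsa : IsSelfAdjoint G := by rw [hGZ]; exact .star_mul_self Z
  have hdiff : ∀ X Y : 𝓜(ℂ, J), Corona.mk J X = Corona.mk J Y →
      (∃ S ∈ cuntzCone G, ∃ k ∈ coronaIdeal J, Y + star Y ≤ S + k) →
      ∃ S ∈ cuntzCone G, ∃ k ∈ coronaIdeal J, X + star X ≤ S + k := by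
    rintro X Y hXY ⟨S, hS, k, hk, hle⟩
    have hd : X - Y ∈ coronaIdeal J := Ideal.Quotient.eq.1 hXY
    refine ⟨S, hS, k + ((X - Y) + star (X - Y)),
      add_mem hk (add_mem hd (coronaIdeal_star_mem J hd)), ?_⟩
    calc X + star X = (Y + star Y) + ((X - Y) + star (X - Y)) := by rw [star_sub]; abel
      _ ≤ (S + k) + ((X - Y) + star (X - Y)) := by gcongr
      _ = _ := by abel
  have hgen : ∀ p r : 𝓜(ℂ, J), ∃ S ∈ cuntzCone G, ∃ k ∈ coronaIdeal J,
      p * G * r + star (p * G * r) ≤ S + k := by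
    intro p r
    refine ⟨star (star p) * G * star p + star r * G * r,
      add_mem_cuntzCone hGsa hG (star_mul_mul_mem_cuntzCone _ _) (star_mul_mul_mem_cuntzCone _ _),
      0, Submodule.zero_mem _, ?_⟩
    rw [add_zero, ← sub_nonneg]
    have : star (star p) * G * star p + star r * G * r - (p * G * r + star (p * G * r)) =
        star (Z * (star p - r)) * (Z * (star p - r)) := by
      rw [hGZ]; simp only [star_mul, star_sub, star_star]; noncomm_ring
    rw [this]
    exact star_mul_self_nonneg _
  rw [TwoSidedIdeal.mem_span_iff_mem_addSubgroup_closure] at hq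
  suffices h : (∀ X : 𝓜(ℂ, J), Corona.mk J X = q →
      (∃ S ∈ cuntzCone G, ∃ k ∈ coronaIdeal J, X + star X ≤ S + k)) ∧
      (∀ X : 𝓜(ℂ, J), Corona.mk J X = -q →
      (∃ S ∈ cuntzCone G, ∃ k ∈ coronaIdeal J, X + star X ≤ S + k)) from h.1
  induction hq using AddSubgroup.closure_induction with
  | mem x hx =>
    obtain ⟨_, ⟨p, -, _, rfl, rfl⟩, r, -, rfl⟩ := hx
    obtain ⟨p, rfl⟩ := Ideal.Quotient.mk_surjective p
    obtain ⟨r, rfl⟩ := Ideal.Quotient.mk_surjective r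
    exact ⟨fun X hX => hdiff X (p * G * r) (by rw [hX]; simp) (hgen p r),
      fun X hX => hdiff X (-p * G * r) (by rw [hX]; simp) (hgen (-p) r)⟩
  | zero =>
    have h0 : ∃ S ∈ cuntzCone G, ∃ k ∈ coronaIdeal J, (0 : 𝓜(ℂ, J)) + star 0 ≤ S + k := by
      simpa using hgen 0 0
    exact ⟨fun X hX => hdiff X 0 (by rw [hX, map_zero]) h0,
      fun X hX => hdiff X 0 (by rw [hX, map_zero, neg_zero]) h0⟩
  | add x y _ _ hx hy =>
    have hadd : ∀ X Y : 𝓜(ℂ, J),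
        (∃ S ∈ cuntzCone G, ∃ k ∈ coronaIdeal J, X + star X ≤ S + k) →
        (∃ S ∈ cuntzCone G, ∃ k ∈ coronaIdeal J, Y + star Y ≤ S + k) →
        ∃ S ∈ cuntzCone G, ∃ k ∈ coronaIdeal J, (X + Y) + star (X + Y) ≤ S + k := by
      rintro X Y ⟨S, hS, k, hk, h1⟩ ⟨T, hT, l, hl, h2⟩
      refine ⟨S + T, add_mem_cuntzCone hGsa hG hS hT, k + l, add_mem hk hl, ?_⟩
      calc (X + Y) + star (X + Y) = (X + star X) + (Y + star Y) := by rw [star_add]; abel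
        _ ≤ (S + k) + (T + l) := add_le_add h1 h2
        _ = _ := by abel
    obtain ⟨a, ha⟩ := Ideal.Quotient.mk_surjective x
    obtain ⟨b, hb⟩ := Ideal.Quotient.mk_surjective y
    refine ⟨fun X hX => hdiff X (a + b) (by rw [hX, map_add, ha, hb])
      (hadd a b (hx.1 a ha) (hy.1 b hb)),
      fun X hX => hdiff X (-a + -b) (by rw [hX, map_add, map_neg, map_neg, ha, hb]; abel)
      (hadd _ _ (hx.2 (-a) (by rw [map_neg, ha])) (hy.2 (-b) (by rw [map_neg, hb])))⟩
  | neg x _ hx => exact ⟨hx.2, fun X hX => hx.1 X (by rw [hX, neg_neg])⟩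

/-- If `G` is properly infinite modulo `J`, full in the corona algebra and Cuntz subequivalent to
`T` modulo `J`, then the unit is Cuntz subequivalent to `T` modulo `J`. -/
theorem exists_half_le_of_isFullSet {G Z T : 𝓜(ℂ, J)} (hGZ : G = star Z * Z)
    (hT : IsSelfAdjoint T)
    (hG : ∀ ε > 0, ∃ r s : 𝓜(ℂ, J), (∃ k ∈ coronaIdeal J, ‖star r * G * r - G - k‖ < ε) ∧
      (∃ k ∈ coronaIdeal J, ‖star s * G * s - G - k‖ < ε) ∧ star r * G * s ∈ coronaIdeal J)
    (hfull : IsFullSet {Corona.mk J G}) (hGT : G ∈ cuntzCone T) :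
    ∃ y : 𝓜(ℂ, J), ∃ k ∈ coronaIdeal J, IsSelfAdjoint k ∧
      algebraMap ℝ 𝓜(ℂ, J) (1 / 2) ≤ star y * T * y + k := by
  have h1 : (1 : Corona J) ∈ closure (TwoSidedIdeal.span {Corona.mk J G} : Set (Corona J)) := by
    have : closedIdealSpan {Corona.mk J G} = Set.univ := hfull
    change 1 ∈ closedIdealSpan {Corona.mk J G}
    rw [this]; trivial
  have hopen : IsOpen (Corona.mk J '' Metric.ball (1 : 𝓜(ℂ, J)) (1 / 2)) :=
    (Submodule.isOpenMap_mkQ (coronaIdeal J)) _ Metric.isOpen_ball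
  obtain ⟨_, ⟨X, hX, rfl⟩, hXs⟩ := mem_closure_iff.1 h1 _ hopen
    ⟨1, Metric.mem_ball_self (by norm_num), map_one _⟩
  obtain ⟨S, hS, k, hk, hle⟩ := exists_add_star_le_of_mk_mem_span hGZ hG hXs X rfl
  have hXle := algebraMap_one_le_add_star_of_norm_sub_one_lt (mem_ball_iff_norm.1 hX)
  obtain ⟨y, l, hl, hy⟩ := cuntzCone_trans hGT hS (1 / 2) (by norm_num)
  have hkl := add_mem hk hl
  refine ⟨y, (1 / 2 : ℝ) • ((k + l) + star (k + l)), ?_,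
    (IsSelfAdjoint.all _).smul (.add_star_self _),
    algebraMap_half_le_of_norm_sub_lt (hXle.trans hle) (hT.conjugate' y) hy⟩
  rw [Algebra.smul_def]
  exact Ideal.mul_mem_left _ _ (add_mem hkl (coronaIdeal_star_mem J hkl))

end CuntzCone

/-! ### Shifts on `ℓ²(ℕ)` -/

/-- The powers of the unilateral shift: isometries whose adjoints tend strongly to `0`. -/
theorem exists_isometries_adjoint_tendsto_zero :
    ∃ v : ℕ → (EllTwo →L[ℂ] EllTwo), (∀ n, star (v n) * v n = 1) ∧
      ∀ ξ : EllTwo, Tendsto (fun n => (star (v n)) ξ) atTop (𝓝 0) := by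
  let b : HilbertBasis ℕ ℂ EllTwo := .ofRepr (LinearIsometryEquiv.refl ℂ EllTwo)
  have hon : ∀ n : ℕ, Orthonormal ℂ (fun i => b (i + n)) := fun n =>
    b.orthonormal.comp _ (add_left_injective n)
  let V : ℕ → EllTwo →ₗᵢ[ℂ] EllTwo := fun n => (hon n).orthogonalFamily.linearIsometry
  let v : ℕ → EllTwo →L[ℂ] EllTwo := fun n => (V n).toContinuousLinearMap
  have hnorm : ∀ n (ξ : EllTwo), ‖(star (v n)) ξ‖ ≤ ‖ξ‖ := by
    intro n ξ
    have h1 : ‖star (v n)‖ ≤ 1 := by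
      rw [ContinuousLinearMap.star_eq_adjoint, LinearIsometryEquiv.norm_map]
      exact (V n).norm_toContinuousLinearMap_le
    simpa using (star (v n)).le_of_opNorm_le h1 ξ
  have hzero : ∀ m n : ℕ, m < n → (star (v n)) (b m) = 0 := by
    intro m n hmn
    refine ext_inner_right ℂ fun η => ?_
    rw [ContinuousLinearMap.star_eq_adjoint, ContinuousLinearMap.adjoint_inner_left, inner_zero_left]
    have h1 := ((hon n).orthogonalFamily.hasSum_linearIsometry η).mapL (innerSL ℂ (b m))
    have h2 : ∀ i, innerSL ℂ (b m) (LinearIsometry.toSpanSingleton ℂ EllTwo ((hon n).1 i) (η i)) =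
        0 := by
      intro i
      simp only [innerSL_apply_apply, LinearIsometry.toSpanSingleton_apply, inner_smul_right]
      rw [b.orthonormal.2 (by omega), mul_zero]
    simp only [h2] at h1
    exact h1.unique hasSum_zero
  refine ⟨v, fun n => ?_, fun ξ => ?_⟩
  · ext1 ξ
    refine ext_inner_right ℂ fun η => ?_
    rw [ContinuousLinearMap.star_eq_adjoint, mul_apply_eq_comp,
      ContinuousLinearMap.adjoint_inner_left]
    exact (V n).inner_map_map ξ η
  · have hspan : ∀ η ∈ Submodule.span ℂ (Set.range b), ∀ᶠ n in atTop, (star (v n)) η = 0 := by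
      intro η hη
      induction hη using Submodule.span_induction with
      | mem x hx =>
        obtain ⟨m, rfl⟩ := hx
        filter_upwards [eventually_gt_atTop m] with n hn using hzero m n hn
      | zero => simp
      | add x y _ _ hx hy => filter_upwards [hx, hy] with n h1 h2 using by rw [map_add, h1, h2, add_zero]
      | smul c x _ hx => filter_upwards [hx] with n h1 using by rw [map_smul, h1, smul_zero]
    rw [Metric.tendsto_atTop]
    intro ε hε
    have hξ : ξ ∈ closure (Submodule.span ℂ (Set.range b) : Set EllTwo) := by
      rw [← Submodule.topologicalClosure_coe, b.dense_span]; trivial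
    obtain ⟨η, hη, hd⟩ := Metric.mem_closure_iff.1 hξ ε hε
    obtain ⟨N, hN⟩ := eventually_atTop.1 (hspan η hη)
    refine ⟨N, fun n hn => ?_⟩
    have h1 : (star (v n)) ξ = (star (v n)) (ξ - η) := by rw [map_sub, hN n hn, sub_zero]
    rw [dist_zero_right, h1]
    rw [dist_eq_norm] at hd
    exact (hnorm n _).trans_lt hd

/-- Strong convergence to zero of contractions becomes norm convergence after multiplication by a
compact operator. -/
theorem IsCompactOperator.tendsto_mul_zero {H : Type*} [NormedAddCommGroup H]
    [InnerProductSpace ℂ H] {k : H →L[ℂ] H} (hk : IsCompactOperator k) {w : ℕ → H →L[ℂ] H}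
    (hw : ∀ n, ‖w n‖ ≤ 1) (hw0 : ∀ ξ, Tendsto (fun n => w n ξ) atTop (𝓝 0)) :
    Tendsto (fun n => w n * k) atTop (𝓝 0) := by
  rw [Metric.tendsto_atTop]
  intro ε hε
  obtain ⟨K, hK, hsub⟩ := IsCompactOperator.image_closedBall_subset_compact
    (f := (k : H →ₗ[ℂ] H)) hk 1
  obtain ⟨t, htf, hcov⟩ := Metric.totallyBounded_iff.1 hK.totallyBounded (ε / 4) (by positivity)
  have hev : ∀ᶠ n in atTop, ∀ y ∈ t, ‖w n y‖ < ε / 4 := by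
    rw [htf.eventually_all]
    intro y _
    have := (Metric.tendsto_atTop.1 (hw0 y)) (ε / 4) (by positivity)
    simpa only [dist_zero_right] using eventually_atTop.2 this
  obtain ⟨N, hN⟩ := eventually_atTop.1 hev
  refine ⟨N, fun n hn => ?_⟩
  rw [dist_zero_right]
  refine lt_of_le_of_lt (b := ε / 2) ?_ (by linarith)
  refine ContinuousLinearMap.opNorm_le_of_unit_norm (𝕜 := ℂ) (by positivity) fun x hx => ?_
  obtain ⟨y, hyt, hy⟩ := Set.mem_iUnion₂.1 (hcov (hsub ⟨x, by simp [hx], rfl⟩))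
  have hy' : ‖k x - y‖ < ε / 4 := by rw [← dist_eq_norm]; exact hy
  have h1 : (w n * k) x = w n (k x - y) + w n y := by
    rw [map_sub, sub_add_cancel]; rfl
  rw [h1]
  refine (norm_add_le _ _).trans ?_
  have h2 := (w n).le_of_opNorm_le (hw n) (k x - y)
  have h3 := hN n hn y hyt
  linarith

/-! ### Isometries in the multiplier algebra of a stable C⋆-algebra -/

section Tensor

variable {J K : Type*} [NonUnitalCStarAlgebra J] [NonUnitalRing K] [Module ℂ K]

theorem lTensor_mul_eq_mul_lTensor [IsScalarTower ℂ K K] [SMulCommClass ℂ K K] {l r : K →ₗ[ℂ] K} (hlr : ∀ x y, r x * y = x * l y)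
    (s t : J ⊗[ℂ] K) : r.lTensor J s * t = s * l.lTensor J t := by
  induction s with
  | zero => simp
  | add s s' hs hs' => simp only [map_add, add_mul, hs, hs']
  | tmul x k =>
    induction t with
    | zero => simp
    | add t t' ht ht' => simp only [map_add, mul_add, ht, ht']
    | tmul y m => simp [Algebra.TensorProduct.tmul_mul_tmul, hlr]

variable [StarRing K] [StarModule ℂ K]

theorem star_lTensor_star_lTensor {l r : K →ₗ[ℂ] K} (h : ∀ x, star (r (star (l x))) = x)
    (t : J ⊗[ℂ] K) : star (r.lTensor J (star (l.lTensor J t))) = t := by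
  induction t with
  | zero => simp
  | add t t' ht ht' => simp only [map_add, star_add, ht, ht']
  | tmul y m => simp [h]

/-- The multiplier `1 ⊗ v` of `J ≅ J ⊗ K` given by an isometry `v` of `M(K)`, which in turn is
given by the left and right multiplication maps `l` and `r`. -/
theorem exists_multiplier_of_isometry [IsScalarTower ℂ K K] [SMulCommClass ℂ K K] {l r : K →ₗ[ℂ] K} (hlr : ∀ x y, r x * y = x * l y)
    (hinv : ∀ x, star (r (star (l x))) = x) (Φ : (J ⊗[ℂ] K) →⋆ₙₐ[ℂ] J)
    (hΦ : DenseRange Φ) :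
    ∃ s : 𝓜(ℂ, J), star s * s = 1 ∧ ∀ t, (star s).fst (s.snd (Φ t)) =
      Φ (star (r.lTensor J (star (r.lTensor J t)))) := by
  let e : (J ⊗[ℂ] K) →ₗ[ℂ] J :=
    { toFun := Φ, map_add' := map_add Φ, map_smul' := map_smul Φ }
  have he : DenseRange e := hΦ
  let L : (J ⊗[ℂ] K) →ₗ[ℂ] J := e ∘ₗ l.lTensor J
  let R : (J ⊗[ℂ] K) →ₗ[ℂ] J := e ∘ₗ r.lTensor J
  have hLiso : ∀ t, ‖L t‖ = ‖e t‖ := by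
    intro t
    refine (mul_self_inj (norm_nonneg _) (norm_nonneg _)).1 ?_
    rw [← CStarRing.norm_star_mul_self, ← CStarRing.norm_star_mul_self]
    change ‖star (Φ (l.lTensor J t)) * Φ (l.lTensor J t)‖ = ‖star (Φ t) * Φ t‖
    rw [← map_star Φ, ← map_star Φ, ← map_mul Φ, ← map_mul Φ, ← lTensor_mul_eq_mul_lTensor hlr]
    congr 3
    rw [← star_inj, star_star, star_lTensor_star_lTensor hinv]
  have hL : ∀ t, ‖L t‖ ≤ 1 * ‖e t‖ := fun t => by rw [one_mul, hLiso]
  -- Right multiplication is contractive as `‖tv‖² = ‖t v v⋆ t⋆‖ ≤ ‖t‖ ‖v v⋆ t⋆‖ = ‖t‖ ‖tv‖`.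
  have hR : ∀ t, ‖R t‖ ≤ 1 * ‖e t‖ := by
    intro t
    have h1 : ‖R t‖ * ‖R t‖ ≤ ‖e t‖ * ‖R t‖ := by
      calc ‖R t‖ * ‖R t‖ = ‖R t * star (R t)‖ := CStarRing.norm_self_mul_star.symm
        _ = ‖e t * L (star (r.lTensor J t))‖ := by
          change ‖Φ (r.lTensor J t) * star (Φ (r.lTensor J t))‖ =
            ‖Φ t * Φ (l.lTensor J (star (r.lTensor J t)))‖
          rw [← map_star Φ, ← map_mul Φ, ← map_mul Φ, lTensor_mul_eq_mul_lTensor hlr]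
        _ ≤ ‖e t‖ * ‖L (star (r.lTensor J t))‖ := norm_mul_le _ _
        _ = ‖e t‖ * ‖R t‖ := by
          rw [hLiso]
          change _ * ‖Φ (star (r.lTensor J t))‖ = _ * ‖Φ (r.lTensor J t)‖
          rw [map_star Φ, norm_star]
    rw [one_mul]
    rcases (norm_nonneg (R t)).eq_or_lt with h0 | h0
    · rw [← h0]; exact norm_nonneg _
    · exact le_of_mul_le_mul_right h1 h0
  have eL : ∀ t, L.extendOfNorm e (Φ t) = Φ (l.lTensor J t) :=
    LinearMap.extendOfNorm_eq he ⟨1, hL⟩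
  have eR : ∀ t, R.extendOfNorm e (Φ t) = Φ (r.lTensor J t) :=
    LinearMap.extendOfNorm_eq he ⟨1, hR⟩
  let s : 𝓜(ℂ, J) :=
    { fst := L.extendOfNorm e
      snd := R.extendOfNorm e
      central := fun x y => by
        refine hΦ.induction_on₂ (p := fun x y => R.extendOfNorm e x * y = x * L.extendOfNorm e y)
          ?_ ?_ x y
        · exact isClosed_eq (by fun_prop) (by fun_prop)
        · intro a b
          rw [eL, eR, ← map_mul Φ, ← map_mul Φ, lTensor_mul_eq_mul_lTensor hlr] }
  have hsL : ∀ t, s.fst (Φ t) = Φ (l.lTensor J t) := eL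
  have hsR : ∀ t, s.snd (Φ t) = Φ (r.lTensor J t) := eR
  refine ⟨s, ?_, fun t => ?_⟩
  · rw [← sub_eq_zero, ← norm_eq_zero, ← DoubleCentralizer.norm_fst, norm_eq_zero,
      DoubleCentralizer.sub_fst, sub_eq_zero]
    refine ContinuousLinearMap.ext fun x => ?_
    refine hΦ.induction_on (p := fun x => (star s * s).fst x = (1 : 𝓜(ℂ, J)).fst x) x ?_ ?_
    · exact isClosed_eq (by fun_prop) (by fun_prop)
    · intro t
      change (star s).fst (s.fst (Φ t)) = Φ t
      rw [DoubleCentralizer.star_fst, hsL, ← map_star Φ, hsR, ← map_star Φ,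
        star_lTensor_star_lTensor hinv]
  · rw [DoubleCentralizer.star_fst, hsR, ← map_star Φ, hsR, ← map_star Φ]

end Tensor

/-- The compact operators form a closed subalgebra of the bounded operators. -/
theorem isClosed_compactOps : IsClosed (compactOps : Set (EllTwo →L[ℂ] EllTwo)) :=
  isClosed_setOfPred_isCompactOperator

/-- Left multiplication by a bounded operator on the compact operators. -/
noncomputable def compactOps.lmul (v : EllTwo →L[ℂ] EllTwo) : compactOps →ₗ[ℂ] compactOps where
  toFun k := ⟨v * k, IsCompactOperator.clm_comp k.2 v⟩
  map_add' _ _ := Subtype.ext (mul_add _ _ _)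
  map_smul' _ _ := Subtype.ext (mul_smul_comm _ _ _)

/-- Right multiplication by a bounded operator on the compact operators. -/
noncomputable def compactOps.rmul (v : EllTwo →L[ℂ] EllTwo) : compactOps →ₗ[ℂ] compactOps where
  toFun k := ⟨k * v, IsCompactOperator.comp_clm k.2 v⟩
  map_add' _ _ := Subtype.ext (add_mul _ _ _)
  map_smul' _ _ := Subtype.ext (smul_mul_assoc _ _ _)

/-- For fixed `x`, a ⋆-homomorphism on `J ⊗ K` is bounded on the elements `x ⊗ k`: the map
`k ↦ Φ (x⋆x ⊗ k)` is positive. -/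
theorem exists_norm_apply_tmul_le {J K C : Type*} [NonUnitalCStarAlgebra J]
    [NonUnitalCStarAlgebra K] [NonUnitalCStarAlgebra C] (Φ : (J ⊗[ℂ] K) →⋆ₙₐ[ℂ] C) (x : J) :
    ∃ c : ℝ, ∀ k : K, ‖Φ (x ⊗ₜ k)‖ ≤ c * ‖k‖ := by
  let _ : PartialOrder K := CStarAlgebra.spectralOrder K
  have : StarOrderedRing K := CStarAlgebra.spectralOrderedRing K
  let _ : PartialOrder C := CStarAlgebra.spectralOrder C
  have : StarOrderedRing C := CStarAlgebra.spectralOrderedRing C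
  have hmul : ∀ k : K, Φ ((star x * x) ⊗ₜ (star k * k)) = star (Φ (x ⊗ₜ k)) * Φ (x ⊗ₜ k) := by
    intro k
    rw [← map_star Φ, ← map_mul Φ, TensorProduct.star_tmul, Algebra.TensorProduct.tmul_mul_tmul]
  let ψ : K →ₗ[ℂ] C :=
    { toFun := fun k => Φ ((star x * x) ⊗ₜ k)
      map_add' := fun k l => by rw [TensorProduct.tmul_add, map_add]
      map_smul' := fun c k => by rw [TensorProduct.tmul_smul, map_smul]; rfl }
  obtain ⟨c, hc⟩ := PositiveLinearMap.exists_norm_apply_le (PositiveLinearMap.mk₀ ψ (fun k hk => by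
    obtain ⟨m, rfl⟩ := CStarAlgebra.nonneg_iff_eq_star_mul_self.1 hk
    change 0 ≤ Φ ((star x * x) ⊗ₜ (star m * m))
    rw [hmul]
    exact star_mul_self_nonneg _))
  refine ⟨√c, fun k => ?_⟩
  have h1 := hc (star k * k)
  change ‖Φ ((star x * x) ⊗ₜ (star k * k))‖ ≤ _ at h1
  rw [hmul, CStarRing.norm_star_mul_self, CStarRing.norm_star_mul_self, ← pow_two, ← pow_two] at h1
  rw [← sq_le_sq₀ (norm_nonneg _) (by positivity), mul_pow, Real.sq_sqrt c.coe_nonneg]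
  exact h1

/-- In a stable C⋆-algebra `J`, every element can be compressed to an arbitrarily small one by an
isometry of `M(J)`. -/
theorem IsStable.exists_isometry_compress_lt {J : Type*} [NonUnitalCStarAlgebra J]
    (hJ : IsStable J) (j : J) {ε : ℝ} (hε : 0 < ε) :
    ∃ s : 𝓜(ℂ, J), star s * s = 1 ∧ ‖(star s).fst (s.snd j)‖ < ε := by
  obtain ⟨Φ, -, hΦ⟩ := hJ
  obtain ⟨v, hv, hv0⟩ := exists_isometries_adjoint_tendsto_zero
  let _ : NonUnitalCStarAlgebra compactOps :=
    NonUnitalStarSubalgebra.nonUnitalCStarAlgebra compactOps (h_closed := isClosed_compactOps)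
  have hvn : ∀ n, ‖v n‖ ≤ 1 := fun n => by
    have h1 : ‖v n‖ * ‖v n‖ = ‖(1 : EllTwo →L[ℂ] EllTwo)‖ := by
      rw [← CStarRing.norm_star_mul_self, hv]
    have h2 : ‖(1 : EllTwo →L[ℂ] EllTwo)‖ ≤ 1 := ContinuousLinearMap.norm_id_le
    nlinarith [norm_nonneg (v n)]
  have hsn : ∀ n, ‖star (v n)‖ ≤ 1 := fun n => by
    rw [ContinuousLinearMap.star_eq_adjoint, LinearIsometryEquiv.norm_map]; exact hvn n
  have hlim : ∀ t : J ⊗[ℂ] compactOps, Tendsto (fun n => Φ (star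
      ((compactOps.rmul (v n)).lTensor J (star ((compactOps.rmul (v n)).lTensor J t)))))
      atTop (𝓝 0) := by
    intro t
    induction t with
    | zero => simp
    | add t t' ht ht' => simpa only [map_add, star_add, add_zero] using ht.add ht'
    | tmul x k =>
      obtain ⟨c, hc⟩ := exists_norm_apply_tmul_le Φ x
      have hk : Tendsto (fun n => ‖star (v n) * (k : EllTwo →L[ℂ] EllTwo)‖) atTop (𝓝 0) :=
        tendsto_zero_iff_norm_tendsto_zero.1 (k.2.tendsto_mul_zero hsn hv0)
      refine squeeze_zero_norm (fun n => ?_) (by simpa using hk.const_mul |c|)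
      simp only [LinearMap.lTensor_tmul, TensorProduct.star_tmul, star_star]
      refine (hc _).trans (mul_le_mul (le_abs_self c) ?_ (norm_nonneg _) (abs_nonneg c))
      change ‖star (star ((k : EllTwo →L[ℂ] EllTwo) * v n) * v n)‖ ≤ _
      rw [star_mul, star_star, ← mul_assoc]
      refine (norm_mul_le _ _).trans ?_
      exact mul_le_of_le_one_right (norm_nonneg _) (hvn n)
  obtain ⟨_, ⟨t, rfl⟩, ht⟩ := Metric.mem_closure_iff.1 (hΦ j) (ε / 2) (by positivity)
  obtain ⟨N, hN⟩ := (Metric.tendsto_atTop.1 (hlim t)) (ε / 2) (by positivity)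
  have hinv : ∀ x : compactOps, star (compactOps.rmul (v N) (star (compactOps.lmul (v N) x))) = x := by
    intro x
    refine Subtype.ext ?_
    change star (star (v N * (x : EllTwo →L[ℂ] EllTwo)) * v N) = x
    rw [star_mul, star_star, ← mul_assoc, hv, one_mul]
  obtain ⟨s, hs, hst⟩ := exists_multiplier_of_isometry (l := compactOps.lmul (v N))
    (r := compactOps.rmul (v N)) (fun x y => Subtype.ext (mul_assoc _ _ _)) hinv Φ hΦ
  have hs1 : ‖s‖ ≤ 1 := by
    rcases subsingleton_or_nontrivial 𝓜(ℂ, J) with h | h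
    · rw [Subsingleton.elim s 0]; simp
    · have h1 : ‖s‖ * ‖s‖ = 1 := by rw [← CStarRing.norm_star_mul_self, hs, CStarRing.norm_one]
      nlinarith [norm_nonneg s]
  have h1 : ‖(star s).fst (s.snd (j - Φ t))‖ ≤ ‖j - Φ t‖ := by
    refine ((star s).fst.le_of_opNorm_le (c := 1) ?_ _).trans ?_
    · rw [DoubleCentralizer.norm_fst, norm_star]; exact hs1
    · rw [one_mul]
      simpa using s.snd.le_of_opNorm_le (c := 1) (by rw [DoubleCentralizer.norm_snd]; exact hs1)
        (j - Φ t)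
  have h2 := hN N le_rfl
  rw [dist_zero_right, ← hst] at h2
  rw [dist_eq_norm] at ht
  refine ⟨s, hs, ?_⟩
  have h3 : (star s).fst (s.snd j) =
      (star s).fst (s.snd (j - Φ t)) + (star s).fst (s.snd (Φ t)) := by
    rw [← map_add, ← map_add, sub_add_cancel]
  rw [h3]
  refine (norm_add_le _ _).trans_lt ?_
  linarith

/-! ### Multipliers acting on the ideal -/

namespace DoubleCentralizer

variable {J : Type*} [NonUnitalCStarAlgebra J]

theorem coeHom_injective : Function.Injective (coeHom (𝕜 := ℂ) (A := J)) := by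
  refine (injective_iff_map_eq_zero _).2 fun x hx => ?_
  have h1 : x * star x = 0 := by
    have := congrArg (fun m : 𝓜(ℂ, J) => m.fst (star x)) hx
    exact this
  exact (CStarRing.mul_star_self_eq_zero_iff x).1 h1

theorem coeHom_fst (m : 𝓜(ℂ, J)) (x : J) :
    coeHom (𝕜 := ℂ) (m.fst x) = m * coeHom (𝕜 := ℂ) x := by
  refine DoubleCentralizer.ext _ _ _ _ (Prod.ext ?_ ?_) <;>
    refine ContinuousLinearMap.ext fun y => ?_
  · change m.fst x * y = m.fst (x * y)
    refine eq_of_sub_eq_zero ((CStarRing.star_mul_self_eq_zero_iff _).1 ?_)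
    rw [mul_sub, ← mul_assoc, ← m.central, ← m.central, mul_assoc, sub_self]
  · exact (m.central _ _).symm

theorem coeHom_snd (m : 𝓜(ℂ, J)) (x : J) :
    coeHom (𝕜 := ℂ) (m.snd x) = coeHom (𝕜 := ℂ) x * m := by
  apply star_injective
  rw [← map_star coeHom, star_mul, ← map_star coeHom, ← coeHom_fst, star_fst, star_star]

/-- Conjugation `j ↦ V j V⋆` of `J` by an isometry `V` of `M(J)`. -/
noncomputable def conjHom (V : 𝓜(ℂ, J)) (hV : star V * V = 1) : J →⋆ₙₐ[ℂ] J where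
  toFun j := V.fst ((star V).snd j)
  map_smul' c j := by simp
  map_zero' := by simp
  map_add' j k := by simp
  map_mul' j k := coeHom_injective (by
    simp only [map_mul, coeHom_fst, coeHom_snd]
    calc V * (coeHom (𝕜 := ℂ) j * coeHom (𝕜 := ℂ) k * star V) =
          V * coeHom (𝕜 := ℂ) j * 1 * coeHom (𝕜 := ℂ) k * star V := by noncomm_ring
      _ = _ := by rw [← hV]; noncomm_ring)
  map_star' j := coeHom_injective (by
    simp only [map_star, coeHom_fst, coeHom_snd, star_mul, star_star, mul_assoc])

theorem coeHom_conjHom (V : 𝓜(ℂ, J)) (hV : star V * V = 1) (j : J) :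
    coeHom (𝕜 := ℂ) (conjHom V hV j) = V * coeHom (𝕜 := ℂ) j * star V := by
  change coeHom (𝕜 := ℂ) (V.fst ((star V).snd j)) = _
  rw [coeHom_fst, coeHom_snd, mul_assoc]

theorem conjHom_injective (V : 𝓜(ℂ, J)) (hV : star V * V = 1) :
    Function.Injective (conjHom V hV) := by
  refine (injective_iff_map_eq_zero _).2 fun j hj => coeHom_injective ?_
  have h1 : star V * coeHom (𝕜 := ℂ) (conjHom V hV j) * V = coeHom (𝕜 := ℂ) j := by
    rw [coeHom_conjHom]
    calc star V * (V * coeHom (𝕜 := ℂ) j * star V) * V =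
          (star V * V) * coeHom (𝕜 := ℂ) j * (star V * V) := by noncomm_ring
      _ = _ := by rw [hV, one_mul, mul_one]
  rw [← h1, hj, map_zero, mul_zero, zero_mul]

theorem isFullSet_range_conjHom (hJσ : IsSigmaUnital J) (V : 𝓜(ℂ, J)) (hV : star V * V = 1) :
    IsFullSet (Set.range (conjHom V hV)) := by
  obtain ⟨u, -, -, -, hu⟩ := hJσ
  refine Set.eq_univ_of_forall fun j => ?_
  have hcl : IsClosed (closedIdealSpan (Set.range (conjHom V hV))) := isClosed_closure
  refine hcl.mem_of_tendsto (hu j).1 (.of_forall fun n => ?_)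
  refine hcl.mem_of_tendsto (hu (u n * j)).2 (.of_forall fun m => ?_)
  have h1 : u n * j * u m = (star V).snd (u n) * conjHom V hV j * V.fst (u m) := by
    apply coeHom_injective
    simp only [map_mul, coeHom_conjHom, coeHom_fst, coeHom_snd]
    calc coeHom (𝕜 := ℂ) (u n) * coeHom (𝕜 := ℂ) j * coeHom (𝕜 := ℂ) (u m) =
          coeHom (𝕜 := ℂ) (u n) * 1 * coeHom (𝕜 := ℂ) j * 1 * coeHom (𝕜 := ℂ) (u m) := by
          rw [mul_one, mul_one]
      _ = _ := by rw [← hV]; noncomm_ring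
  rw [h1]
  exact mul_mem_closedIdealSpan_right _ (mul_mem_closedIdealSpan_left _
    (subset_closedIdealSpan (TwoSidedIdeal.subset_span ⟨j, rfl⟩)))

end DoubleCentralizer

/-! ### Transport along isomorphisms -/

open scoped CStarAlgebra in
theorem IsSigmaUnital.of_surjective {J D : Type*} [NonUnitalCStarAlgebra J]
    [NonUnitalCStarAlgebra D] (hJ : IsSigmaUnital J) (ψ : J →⋆ₙₐ[ℂ] D)
    (hψ : Function.Surjective ψ) : IsSigmaUnital D := by
  obtain ⟨u, hpos, hn, hmono, hu⟩ := hJ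
  have hcone : ∀ x ∈ positiveCone J, ψ x ∈ positiveCone D := by
    rintro _ ⟨b, rfl⟩
    exact ⟨ψ b, by rw [map_mul, map_star]⟩
  have hc : Continuous ψ := map_continuous ψ
  refine ⟨fun n => ψ (u n), fun n => hcone _ (hpos n),
    fun n => (NonUnitalStarAlgHom.norm_apply_le ψ _).trans (hn n),
    fun m n hmn => by rw [← map_sub]; exact hcone _ (hmono m n hmn), fun a => ?_⟩
  obtain ⟨x, rfl⟩ := hψ a
  simp only [← map_mul]
  exact ⟨(hc.tendsto x).comp (hu x).1, (hc.tendsto x).comp (hu x).2⟩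

section TensorMap

variable {J D K : Type*} [NonUnitalCStarAlgebra J] [NonUnitalCStarAlgebra D] [NonUnitalRing K]
  [Module ℂ K] [StarRing K] [StarModule ℂ K] [IsScalarTower ℂ K K] [SMulCommClass ℂ K K]

/-- The ⋆-homomorphism `f ⊗ id` on algebraic tensor products. -/
noncomputable def rTensorStarHom (K : Type*) [NonUnitalRing K]
    [Module ℂ K] [StarRing K] [StarModule ℂ K] [IsScalarTower ℂ K K] [SMulCommClass ℂ K K]
    (f : D →⋆ₙₐ[ℂ] J) : (D ⊗[ℂ] K) →⋆ₙₐ[ℂ] (J ⊗[ℂ] K) where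
  toFun := ({ toFun := f, map_add' := map_add f, map_smul' := map_smul f } : D →ₗ[ℂ] J).rTensor K
  map_smul' := map_smul _
  map_zero' := map_zero _
  map_add' := map_add _
  map_mul' s t := by
    induction s with
    | zero => simp
    | add s s' hs hs' => simp only [map_add, add_mul, hs, hs']
    | tmul x k =>
      induction t with
      | zero => simp
      | add t t' ht ht' => simp only [map_add, mul_add, ht, ht']
      | tmul y m => simp [Algebra.TensorProduct.tmul_mul_tmul]
  map_star' t := by
    induction t with
    | zero => simp
    | add t t' ht ht' => simp only [map_add, star_add, ht, ht']
    | tmul y m => simp [map_star f]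

theorem rTensorStarHom_bijective (f : D →⋆ₙₐ[ℂ] J) (hf : Function.Bijective f) :
    Function.Bijective (rTensorStarHom K f) :=
  (LinearEquiv.rTensor K (LinearEquiv.ofBijective
    ({ toFun := f, map_add' := map_add f, map_smul' := map_smul f } : D →ₗ[ℂ] J) hf)).bijective

end TensorMap

open scoped CStarAlgebra in
theorem IsStable.of_bijective {J D : Type*} [NonUnitalCStarAlgebra J]
    [NonUnitalCStarAlgebra D] (hJ : IsStable J) (ψ : J →⋆ₙₐ[ℂ] D)
    (hψ : Function.Bijective ψ) : IsStable D := by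
  obtain ⟨Φ, hinj, hd⟩ := hJ
  let e : J ≃⋆ₐ[ℂ] D := StarAlgEquiv.ofBijective ψ hψ
  let f : D →⋆ₙₐ[ℂ] J := (e.symm : D →⋆ₙₐ[ℂ] J)
  have hf : Function.Bijective (rTensorStarHom compactOps f) :=
    rTensorStarHom_bijective f e.symm.bijective
  refine ⟨(ψ.comp Φ).comp (rTensorStarHom compactOps f), ?_, ?_⟩
  · exact (hψ.1.comp hinj).comp hf.1
  · have h1 : DenseRange (ψ ∘ Φ) := hψ.2.denseRange.comp hd (map_continuous ψ)
    change Dense (Set.range ((ψ ∘ Φ) ∘ rTensorStarHom compactOps f))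
    rwa [hf.2.range_comp]

/-! ### Full extensions -/

namespace CStarExtension

variable {J A B : Type*} [NonUnitalCStarAlgebra J] [NonUnitalCStarAlgebra A]
  [NonUnitalCStarAlgebra B] (E : CStarExtension J A B)

theorem toMultiplier_mem_coronaIdeal {a : A} (ha : E.proj a = 0) :
    E.toMultiplier a ∈ coronaIdeal J := by
  obtain ⟨j, rfl⟩ := (E.exact a).1 ha
  exact ⟨j, (E.toMultiplier_incl j).symm⟩

open scoped CStarAlgebra in
/-- By the open mapping theorem, a norm estimate in `B` lifts to one in `M(J)` modulo `J`. -/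
theorem exists_norm_toMultiplier_sub_le :
    ∃ C > 0, ∀ a : A, ∃ k ∈ coronaIdeal J, ‖E.toMultiplier a - k‖ ≤ C * ‖E.proj a‖ := by
  let f : A →L[ℂ] B :=
    { toFun := E.proj, map_add' := map_add E.proj, map_smul' := map_smul E.proj,
      cont := map_continuous E.proj }
  obtain ⟨C, hC, h⟩ := f.exists_preimage_norm_le E.proj_surjective
  refine ⟨C, hC, fun a => ?_⟩
  obtain ⟨x, hx, hxn⟩ := h (E.proj a)
  refine ⟨E.toMultiplier (a - x), E.toMultiplier_mem_coronaIdeal ?_, ?_⟩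
  · rw [map_sub, sub_eq_zero]; exact hx.symm
  · rw [← map_sub, sub_sub_cancel]
    exact (NonUnitalStarAlgHom.norm_apply_le E.toMultiplier x).trans hxn

/-- The unit of `M(J)` is Cuntz subequivalent to `a⋆a` modulo `J`. -/
theorem exists_half_le [PartialOrder 𝓜(ℂ, J)] [StarOrderedRing 𝓜(ℂ, J)]
    (hB : IsPurelyInfinite B) (hE : E.IsFull) {a : A} (ha : a ∉ Set.range E.incl) :
    ∃ y : 𝓜(ℂ, J), ∃ k ∈ coronaIdeal J, IsSelfAdjoint k ∧
      algebraMap ℝ 𝓜(ℂ, J) (1 / 2) ≤ star y * E.toMultiplier (star a * a) * y + k := by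
  obtain ⟨C, hC, hlift⟩ := E.exists_norm_toMultiplier_sub_le
  have hpa : E.proj a ≠ 0 := fun h => ha ((E.exact a).1 h)
  have hb : E.proj (star a * a) = star (E.proj a) * E.proj a := by rw [map_mul, map_star]
  obtain ⟨c, hc0, hcb, ⟨z, hz⟩, hc⟩ := hB.exists_properlyInfinite (b := E.proj (star a * a))
    ⟨_, hb⟩ (by rw [hb, Ne, CStarRing.star_mul_self_eq_zero_iff]; exact hpa)
  obtain ⟨z, rfl⟩ := E.proj_surjective z
  have hzc : E.proj (star z * z) = c := by rw [hz, map_mul, map_star]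
  have hconj : ∀ x d y : A, star (E.toMultiplier x) * E.toMultiplier d * E.toMultiplier y =
      E.toMultiplier (star x * d * y) := fun x d y => by rw [map_mul, map_mul, map_star]
  have happrox : ∀ d d' : A, ∀ ε > 0, ‖E.proj d - E.proj d'‖ < ε / C →
      ∃ k ∈ coronaIdeal J, ‖E.toMultiplier d - E.toMultiplier d' - k‖ < ε := by
    intro d d' ε _ h
    obtain ⟨k, hk, hkn⟩ := hlift (d - d')
    refine ⟨k, hk, ?_⟩
    rw [← map_sub]
    refine hkn.trans_lt ?_
    rw [map_sub]
    rwa [lt_div_iff₀' hC] at h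
  refine exists_half_le_of_isFullSet (G := E.toMultiplier (star z * z)) (Z := E.toMultiplier z)
    (by rw [map_mul, map_star]) ?_ ?_ ?_ ?_
  · rw [map_mul, map_star]; exact .star_mul_self _
  · intro ε hε
    obtain ⟨r, s, hr, hs, hrs⟩ := hc (ε / C) (by positivity)
    obtain ⟨r, rfl⟩ := E.proj_surjective r
    obtain ⟨s, rfl⟩ := E.proj_surjective s
    refine ⟨E.toMultiplier r, E.toMultiplier s, ?_, ?_, ?_⟩
    · rw [hconj]
      refine happrox _ _ ε hε ?_
      rwa [map_mul, map_mul, map_star, hzc]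
    · rw [hconj]
      refine happrox _ _ ε hε ?_
      rwa [map_mul, map_mul, map_star, hzc]
    · rw [hconj]
      refine E.toMultiplier_mem_coronaIdeal ?_
      rwa [map_mul, map_mul, map_star, hzc]
  · rw [← E.busby_proj, hzc]
    exact hE c hc0
  · intro ε hε
    obtain ⟨t, ht⟩ := hcb.exists_norm_sub_lt (ε := ε / C) (by positivity)
    obtain ⟨t, rfl⟩ := E.proj_surjective t
    refine ⟨E.toMultiplier t, ?_⟩
    rw [hconj]
    refine happrox _ _ ε hε ?_
    rw [hzc, map_mul, map_mul, map_star, norm_sub_rev]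
    exact ht

/-- Every `a ∉ J` has a right multiple `a m`, with `m ∈ M(J)`, that is an isometry of `M(J)`. -/
theorem exists_isometry (hB : IsPurelyInfinite B) (hJ : IsStable J) (hE : E.IsFull) {a : A}
    (ha : a ∉ Set.range E.incl) :
    ∃ m : 𝓜(ℂ, J), star (E.toMultiplier a * m) * (E.toMultiplier a * m) = 1 := by
  let _ : PartialOrder 𝓜(ℂ, J) := CStarAlgebra.spectralOrder _
  have : StarOrderedRing 𝓜(ℂ, J) := CStarAlgebra.spectralOrderedRing _
  obtain ⟨y, k, ⟨j, rfl⟩, hk, hle⟩ := E.exists_half_le hB hE ha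
  obtain ⟨s, hs, hsj⟩ := hJ.exists_isometry_compress_lt j (ε := 1 / 4) (by norm_num)
  set κ : 𝓜(ℂ, J) := DoubleCentralizer.coeHom (𝕜 := ℂ) j with hκ
  set T : 𝓜(ℂ, J) := E.toMultiplier (star a * a) with hT
  have hcomp : star s * κ * s ≤ algebraMap ℝ 𝓜(ℂ, J) (1 / 4) := by
    refine (hk.conjugate' s).le_algebraMap_norm_self.trans (algebraMap_mono _ ?_)
    rw [hκ, mul_assoc, ← DoubleCentralizer.coeHom_snd, ← DoubleCentralizer.coeHom_fst]
    exact (NonUnitalStarAlgHom.norm_apply_le _ _).trans hsj.le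
  set R : 𝓜(ℂ, J) := star (y * s) * T * (y * s) with hR
  have hRle : algebraMap ℝ 𝓜(ℂ, J) (1 / 4) ≤ R := by
    have h1 := star_left_conjugate_le_conjugate hle s
    rw [← Algebra.commutes, mul_assoc, hs, mul_one, mul_add, add_mul] at h1
    have h2 : star s * (star y * T * y) * s = R := by rw [hR, star_mul]; noncomm_ring
    rw [h2] at h1
    have h3 := h1.trans (add_le_add_right hcomp R)
    have e : algebraMap ℝ 𝓜(ℂ, J) (1 / 2) =
        algebraMap ℝ 𝓜(ℂ, J) (1 / 4) + algebraMap ℝ 𝓜(ℂ, J) (1 / 4) := by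
      rw [← map_add]; norm_num
    rw [e] at h3
    exact le_of_add_le_add_right h3
  have hpos : IsStrictlyPositive (algebraMap ℝ 𝓜(ℂ, J) (1 / 4)) :=
    isStrictlyPositive_algebraMap (by norm_num)
  have hRpos : IsStrictlyPositive R := hpos.of_le hRle
  have hroot : IsSelfAdjoint (R ^ (-(1 / 2) : ℝ)) := .of_nonneg CFC.rpow_nonneg
  refine ⟨y * s * R ^ (-(1 / 2) : ℝ), ?_⟩
  rw [← CFC.conjugate_rpow_neg_one_half R hRpos]
  nth_rw 4 [hR]
  rw [hT, map_mul, map_star]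
  simp only [star_mul, hroot.star_eq]
  noncomm_ring

end CStarExtension

theorem mainTheorem3 {J A B : Type*} [NonUnitalCStarAlgebra J] [NonUnitalCStarAlgebra A]
    [NonUnitalCStarAlgebra B] (E : CStarExtension J A B) (hB : IsPurelyInfinite B)
    (hJ : IsStable J) (hJσ : IsSigmaUnital J) (hE : E.IsFull) :
    E.IsPurelyLarge := by
  intro a ha
  obtain ⟨m, hm⟩ := E.exists_isometry hB hJ hE ha
  set φ : J →⋆ₙₐ[ℂ] J := DoubleCentralizer.conjHom _ hm with hφ
  have hinj : Function.Injective φ := DoubleCentralizer.conjHom_injective _ hm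
  have hrange : ((NonUnitalStarAlgHom.range φ : NonUnitalStarSubalgebra ℂ J) : Set J) =
      Set.range φ := NonUnitalStarAlgHom.coe_range φ
  have hD : IsClosed ((NonUnitalStarAlgHom.range φ : NonUnitalStarSubalgebra ℂ J) : Set J) := by
    rw [hrange]
    exact (NonUnitalStarAlgHom.isometry φ hinj).isClosedEmbedding.isClosed_range
  refine ⟨NonUnitalStarAlgHom.range φ, hD, ?_⟩
  let _ : NonUnitalCStarAlgebra (NonUnitalStarAlgHom.range φ) :=
    NonUnitalStarSubalgebra.nonUnitalCStarAlgebra _ (h_closed := hD)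
  let ψ : J →⋆ₙₐ[ℂ] (NonUnitalStarAlgHom.range φ) := NonUnitalStarAlgHom.rangeRestrict φ
  have hψ : Function.Bijective ψ :=
    ⟨fun x y h => hinj (congrArg Subtype.val h), fun ⟨_, x, hx⟩ => ⟨x, Subtype.ext hx⟩⟩
  refine ⟨?_, hJ.of_bijective ψ hψ, hJσ.of_surjective ψ hψ.2, ?_⟩
  · rw [hrange]
    rintro _ ⟨_, ⟨j, rfl⟩, rfl⟩
    refine subset_closure ⟨m.fst ((star m).snd j), ?_⟩
    have h1 : φ j = (E.toMultiplier a).fst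
        ((E.toMultiplier (star a)).snd (m.fst ((star m).snd j))) := by
      apply DoubleCentralizer.coeHom_injective
      simp only [hφ, DoubleCentralizer.coeHom_conjHom, DoubleCentralizer.coeHom_fst,
        DoubleCentralizer.coeHom_snd, map_star, star_mul, mul_assoc]
    rw [h1]
    change a * E.incl _ * star a = E.incl (E.leftMul a (E.rightMul (star a) _))
    rw [E.incl_leftMul, E.incl_rightMul, mul_assoc]
  · rw [hrange]
    exact DoubleCentralizer.isFullSet_range_conjHom hJσ _ hm
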